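/- **Theorem (representation guarantee for pure sinusoids).** Let $N\ge 1$ be an integer and $W\in(0,\tfrac12)$ with $W\ge \frac{1}{4\pi N}$. For $f\in\mathbb R$ let $e_f=(e^{j2\pi f n})_{n=0}^{N-1}\in\mathbb C^N$. Let $F_{N,W}$ be the $N\times(2\lfloor NW\rfloor+1)$ matrix with columns $\frac1{\sqrt N}e_{\ell/N}$ for $\ell=-\lfloor NW\rfloor,\dots,\lfloor NW\rfloor$, and let $\overline F_{N,W}$ be the $N\times M$ matrix, $M:=N-2\lfloor NW\rfloor-1$, with columns $\frac1{\sqrt N}e_{\ell/N}$ for the remaining DFT frequencies $\ell=\lfloor NW\rfloor+1,\dots,N-\lfloor NW\rfloor-1$. Let $B_{N,W}$ be the $N\times N$ prolate matrix with entries $B_{N,W}[m,n]=\frac{\sin(2\pi W(m-n))}{\pi(m-n)}$ for $m\ne n$ and $B_{N,W}[n,n]=2W$, and let $C_N=\frac{4}{\pi^2}\log(8N)+6$. For any $\epsilon\in(0,\tfrac12)$ set $$R=\max\left(\left\lceil C_N\log\left(\frac{60\pi C_N}{\epsilon^2}\right)\right\rceil+1,\ \left\lceil C_N\log\left(\frac{15C_N}{NW\epsilon}\right)\right\rceil+1\right),$$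 and let the columns of $V$ be the $R$ dominant left singular vectors of $\overline F_{N,W}^*B_{N,W}$ (all $M$ left singular vectors if $R>M$), that is, the first $\min(R,M)$ columns of $U$ in any singular value decomposition $\overline F_{N,W}^*B_{N,W}=U\Sigma Y^*$ with $U,Y$ unitary and singular values in decreasing order. Then the matrix $Q=[\,F_{N,W}\ \ \overline F_{N,W}V\,]$ has orthonormal columns, and $$\frac{\|e_f-QQ^*e_f\|_2^2}{\|e_f\|_2^2}\le\epsilon\qquad\text{for all } f\in[-W,W].$$ -/

import Mathlib

open scoped Matrix

noncomputable section

namespace Roast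

/-- The sampled complex exponential `e_f = (exp (2 π j f n))_{0 ≤ n < N} ∈ ℂ^N`. -/
def sinusoid (N : ℕ) (f : ℝ) : EuclideanSpace ℂ (Fin N) :=
  WithLp.toLp 2 fun n => Complex.exp (2 * (Real.pi : ℂ) * Complex.I * (f : ℂ) * ((n : ℕ) : ℂ))

/-- The `N × N` prolate matrix `B[m,n] = sin (2πW(m-n)) / (π(m-n))`; the diagonal entries are the
limit value `2W`. -/
def prolate (N : ℕ) (W : ℝ) : Matrix (Fin N) (Fin N) ℂ :=
  Matrix.of fun m n =>
    if m = n then ((2 * W : ℝ) : ℂ)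
    else ((Real.sin (2 * Real.pi * W * ((m : ℝ) - (n : ℝ))) /
      (Real.pi * ((m : ℝ) - (n : ℝ))) : ℝ) : ℂ)

/-- `⌊N W⌋`. -/
def bandIndex (N : ℕ) (W : ℝ) : ℕ := ⌊(N : ℝ) * W⌋₊

/-- The number of low DFT frequencies, `2⌊NW⌋ + 1`. -/
abbrev lowDim (N : ℕ) (W : ℝ) : ℕ := 2 * bandIndex N W + 1

/-- The number of high DFT frequencies, `N - 2⌊NW⌋ - 1`
(no truncation for `0 < N`, `0 ≤ W < 1/2`). -/
abbrev highDim (N : ℕ) (W : ℝ) : ℕ := N - 2 * bandIndex N W - 1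

/-- The partial normalized DFT matrix `F_{N,W}`, with columns `e_{ℓ/N} / √N` for
`ℓ = -⌊NW⌋, …, ⌊NW⌋`. -/
def lowDFT (N : ℕ) (W : ℝ) : Matrix (Fin N) (Fin (lowDim N W)) ℂ :=
  Matrix.of fun n i =>
    ((1 / Real.sqrt N : ℝ) : ℂ) *
      sinusoid N ((((i : ℕ) : ℝ) - (bandIndex N W : ℝ)) / (N : ℝ)) n

/-- The complementary partial normalized DFT matrix, with columns `e_{ℓ/N} / √N` for
`ℓ = ⌊NW⌋ + 1, …, N - ⌊NW⌋ - 1` (the remaining frequencies modulo `N`). -/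
def highDFT (N : ℕ) (W : ℝ) : Matrix (Fin N) (Fin (highDim N W)) ℂ :=
  Matrix.of fun n i =>
    ((1 / Real.sqrt N : ℝ) : ℂ) *
      sinusoid N (((bandIndex N W : ℝ) + 1 + ((i : ℕ) : ℝ)) / (N : ℝ)) n

/-- `A = U Σ Yᴴ` is a singular value decomposition of the `m × n` matrix `A`, with the singular
values `σ 0 ≥ σ 1 ≥ … ≥ 0` in decreasing order on the main diagonal of `Σ`
(only the values `σ i` with `i < min m n` occur in `Σ`). -/
structure IsSVD {m n : ℕ} (A : Matrix (Fin m) (Fin n) ℂ) (U : Matrix (Fin m) (Fin m) ℂ)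
    (σ : ℕ → ℝ) (Y : Matrix (Fin n) (Fin n) ℂ) : Prop where
  left_unitary : U ∈ Matrix.unitaryGroup (Fin m) ℂ
  right_unitary : Y ∈ Matrix.unitaryGroup (Fin n) ℂ
  antitone : Antitone σ
  nonneg : ∀ i, 0 ≤ σ i
  eq_mul : A = U * (Matrix.of fun (i : Fin m) (j : Fin n) =>
    if (i : ℕ) = (j : ℕ) then ((σ i : ℝ) : ℂ) else 0) * Yᴴ

/-- The columns of `V` are `r` dominant left singular vectors of `A`: the first `r` left singular
vectors in some singular value decomposition of `A`. -/
def IsDominantLeftSingular {m n r : ℕ} (A : Matrix (Fin m) (Fin n) ℂ)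
    (V : Matrix (Fin m) (Fin r) ℂ) : Prop :=
  ∃ (U : Matrix (Fin m) (Fin m) ℂ) (σ : ℕ → ℝ) (Y : Matrix (Fin n) (Fin n) ℂ) (h : r ≤ m),
    IsSVD A U σ Y ∧ V = U.submatrix id (Fin.castLE h)

/-- The ROAST matrix `Q = [F_{N,W}  F̄_{N,W} V]`. -/
def basis (N : ℕ) (W : ℝ) {r : ℕ} (V : Matrix (Fin (highDim N W)) (Fin r) ℂ) :
    Matrix (Fin N) (Fin (lowDim N W) ⊕ Fin r) ℂ :=
  Matrix.fromCols (lowDFT N W) (highDFT N W * V)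

/-- The constant `C_N = (4/π²) log (8N) + 6`. -/
def C (N : ℕ) : ℝ := 4 / Real.pi ^ 2 * Real.log (8 * (N : ℝ)) + 6

end Roast

end

/-! Write $P = I - QQ^*$. Since $B = \int_{-W}^{W} e_f e_f^*\,df$, the residual energy $\|Pe_f\|^2$
integrates over the band to $\mathrm{tr}(PB)$. The low DFT columns all lie in $Q$, so $P = \overline
F(I - VV^*)\overline F^*$ and the trace is at most the sum of the discarded singular values of $A =
\overline F^*B$ (`norm_trace_tail_le`). The energy is $2\pi N^2$-Lipschitz in $f$, so an integral of
at most $\epsilon^2/(4\pi)$ forces it below $N\epsilon$ pointwise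
(`le_of_lipschitz_of_integral_le`).

What remains is the decay of the singular values (`singular_value_le`). Row $i$ of $Ax$ is
$N^{-1/2}\int \hat x(f) D(f-g_i)\,df$ over the band. As $Ng_i$ is an integer, the Dirichlet kernel
$D(f-g_i)$ is Cauchy-like: a function of $f$ times a function of $g_i$, over $\sin\pi(f-g_i)$. Let
$r$ be a product of $n$ ratios of forms $a\cos\pi f + b\sin\pi f$. If $n$ linear functionals vanish
at $x$, multiplying $\hat x$ by $r$ multiplies the transform at $g_i$ by $r(g_i)$
(`exists_functionals_trigRatio`). So $\|Ax\|$ is controlled by $\max|r|$ on the band times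
$\max|1/r|$ on the high frequencies: a Zolotarev problem.

A Möbius coordinate sends the band into $[1/(2N), 2N]$ and the separated high frequencies into its
negative. Zeros in geometric progression of ratio 9, about $\log_3(2N)$ of them per period, gain
$1/4$ on each side (`exists_separating_forms`). Then $m$ periods give $16^{-m}$ by min-max, and
summing the tail with the given $R$ yields $\epsilon^2/(4\pi)$ (`sum_discarded_le`). -/

namespace Roast

/-! ### Energy and matrices with orthonormal columns -/

section Energy

variable {m n : Type*} [Fintype m] [Fintype n]

theorem star_dotProduct_self (v : n → ℂ) : star v ⬝ᵥ v = ((∑ i, ‖v i‖ ^ 2 : ℝ) : ℂ) := by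
  simp only [dotProduct, Pi.star_apply, Complex.ofReal_sum]
  refine Finset.sum_congr rfl fun i _ => ?_
  have h := Complex.conj_mul' (v i)
  simpa using h

/-- A matrix with orthonormal columns preserves the energy. -/
theorem sum_norm_sq_mulVec [DecidableEq n] {A : Matrix m n ℂ} (hA : Aᴴ * A = 1) (v : n → ℂ) :
    ∑ i, ‖(A *ᵥ v) i‖ ^ 2 = ∑ i, ‖v i‖ ^ 2 := by
  have h : star (A *ᵥ v) ⬝ᵥ (A *ᵥ v) = star v ⬝ᵥ v := by
    rw [Matrix.star_mulVec, ← Matrix.dotProduct_mulVec, Matrix.mulVec_mulVec, hA, Matrix.one_mulVec]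
  rw [star_dotProduct_self, star_dotProduct_self] at h
  exact_mod_cast h

/-- The entries of a matrix with orthonormal columns are bounded by one. -/
theorem norm_apply_le_one [DecidableEq n] {A : Matrix m n ℂ} (hA : Aᴴ * A = 1) (i : m) (j : n) :
    ‖A i j‖ ≤ 1 := by
  have h := sum_norm_sq_mulVec hA (Pi.single j 1)
  have h1 : ∑ k, ‖(Pi.single j (1 : ℂ) : n → ℂ) k‖ ^ 2 = 1 := by
    rw [Finset.sum_eq_single j] <;> simp +contextual
  rw [h1] at h
  have h2 : ‖(A *ᵥ Pi.single j 1) i‖ ^ 2 ≤ 1 := by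
    rw [← h]
    exact Finset.single_le_sum (f := fun k => ‖(A *ᵥ Pi.single j 1) k‖ ^ 2)
      (fun k _ => by positivity) (Finset.mem_univ i)
  have h3 : (A *ᵥ Pi.single j 1) i = A i j := by simp
  rw [h3] at h2
  exact (sq_le_one_iff₀ (norm_nonneg _)).1 h2

end Energy

/-! ### The DFT basis and its low/high splitting -/

section DFT

theorem sinusoid_apply (N : ℕ) (f : ℝ) (n : Fin N) : sinusoid N f n =
    Complex.exp (2 * (Real.pi : ℂ) * Complex.I * (f : ℂ) * ((n : ℕ) : ℂ)) := rfl

theorem norm_sinusoid_apply (N : ℕ) (f : ℝ) (n : Fin N) : ‖sinusoid N f n‖ = 1 := by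
  rw [sinusoid_apply, show 2 * (Real.pi : ℂ) * Complex.I * (f : ℂ) * ((n : ℕ) : ℂ) =
    ((2 * Real.pi * f * (n : ℕ) : ℝ) : ℂ) * Complex.I by push_cast; ring]
  exact Complex.norm_exp_ofReal_mul_I _

theorem star_sinusoid_apply (N : ℕ) (f : ℝ) (n : Fin N) :
    star (sinusoid N f n) = sinusoid N (-f) n := by
  simp only [sinusoid_apply, Complex.star_def, ← Complex.exp_conj]
  congr 1
  simp only [map_mul, Complex.conj_ofReal, Complex.conj_I, map_natCast, Complex.ofReal_neg,
    map_ofNat]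
  ring

theorem sinusoid_apply_mul (N : ℕ) (f g : ℝ) (n : Fin N) :
    sinusoid N f n * sinusoid N g n = sinusoid N (f + g) n := by
  simp only [sinusoid_apply, ← Complex.exp_add]
  congr 1
  push_cast; ring

theorem norm_sq_sinusoid (N : ℕ) (f : ℝ) : ‖sinusoid N f‖ ^ 2 = N := by
  rw [EuclideanSpace.norm_sq_eq]
  simp [norm_sinusoid_apply]

/-- The geometric sum behind the Dirichlet kernel. -/
theorem sum_sinusoid_mul (N : ℕ) (f : ℝ) :
    (∑ n, sinusoid N f n) * (Complex.exp (2 * Real.pi * Complex.I * f) - 1) =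
      Complex.exp (2 * Real.pi * Complex.I * (N * f)) - 1 := by
  have h : ∀ n : Fin N, sinusoid N f n =
      Complex.exp (2 * Real.pi * Complex.I * f) ^ (n : ℕ) := fun n => by
    rw [sinusoid_apply, ← Complex.exp_nat_mul]
    congr 1; ring
  simp only [h]
  rw [Fin.sum_univ_eq_sum_range (fun i => Complex.exp (2 * Real.pi * Complex.I * f) ^ i),
    geom_sum_mul, ← Complex.exp_nat_mul]
  congr 2
  ring

theorem sum_sinusoid_eq_zero {N : ℕ} {a : ℤ} (h0 : a ≠ 0) (h : |a| < N) :
    ∑ n, sinusoid N ((a : ℝ) / N) n = 0 := by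
  have hN : (N : ℂ) ≠ 0 := by
    rintro h'
    have : N = 0 := by exact_mod_cast h'
    subst this
    exact absurd (abs_nonneg a) (not_le.2 (by exact_mod_cast h))
  have h1 := sum_sinusoid_mul N ((a : ℝ) / N)
  have h2 : Complex.exp (2 * Real.pi * Complex.I * (N * (((a : ℝ) / N : ℝ) : ℂ))) = 1 := by
    rw [Complex.exp_eq_one_iff]
    refine ⟨a, ?_⟩
    push_cast
    field_simp
  rw [h2, sub_self] at h1
  refine (mul_eq_zero.1 h1).resolve_right fun h3 => ?_
  obtain ⟨b, hb⟩ := Complex.exp_eq_one_iff.1 (sub_eq_zero.1 h3)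
  have hpi : (2 * Real.pi * Complex.I : ℂ) ≠ 0 := Complex.two_pi_I_ne_zero
  have h4 : (a : ℂ) = b * N := by
    push_cast at hb
    have : (2 * Real.pi * Complex.I : ℂ) * ((a : ℂ) / N) = (2 * Real.pi * Complex.I) * b := by
      rw [hb]; ring
    have := mul_left_cancel₀ hpi this
    field_simp at this
    rw [this, mul_comm]
  have h5 : a = b * N := by exact_mod_cast h4
  have hb0 : b ≠ 0 := by rintro rfl; exact h0 (by simpa using h5)
  rw [h5, abs_mul, Nat.abs_cast] at h
  have : (1 : ℤ) ≤ |b| := Int.one_le_abs hb0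
  nlinarith [Int.natCast_nonneg N]

/-- A matrix of normalized DFT columns with frequencies distinct modulo `N` is orthonormal. -/
theorem dft_orthonormal {N : ℕ} (hN : 0 < N) {ι : Type*} [Fintype ι] [DecidableEq ι]
    {l : ι → ℤ} (hl : ∀ i j, i ≠ j → l i ≠ l j ∧ |l j - l i| < N)
    (A : Matrix (Fin N) ι ℂ)
    (hA : ∀ n i, A n i = ((1 / Real.sqrt N : ℝ) : ℂ) * sinusoid N ((l i : ℝ) / N) n) :
    Aᴴ * A = 1 := by
  ext i j
  have h1 : ∀ n, Aᴴ i n * A n j = (1 / (N : ℂ)) * sinusoid N (((l j - l i : ℤ) : ℝ) / N) n := by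
    intro n
    rw [Matrix.conjTranspose_apply, hA, hA, star_mul', star_sinusoid_apply]
    have h2 : star ((1 / Real.sqrt N : ℝ) : ℂ) = ((1 / Real.sqrt N : ℝ) : ℂ) :=
      Complex.conj_ofReal _
    rw [h2, show ∀ a b c : ℂ, a * b * (a * c) = a * a * (b * c) from fun _ _ _ => by ring,
      sinusoid_apply_mul, ← Complex.ofReal_mul]
    congr 1
    · rw [div_mul_div_comm, Real.mul_self_sqrt (Nat.cast_nonneg N)]
      push_cast; ring
    · exact congrArg (fun x => sinusoid N x n) (by push_cast; ring)
  rw [Matrix.mul_apply]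
  simp only [h1, ← Finset.mul_sum]
  by_cases hij : i = j
  · subst hij
    have hN' : (N : ℂ) ≠ 0 := by exact_mod_cast hN.ne'
    simp [sinusoid_apply, hN']
  · rw [Matrix.one_apply_ne hij, sum_sinusoid_eq_zero _ (hl i j hij).2, mul_zero]
    exact sub_ne_zero.2 (hl i j hij).1.symm

theorem lowDim_le {N : ℕ} (hN : 0 < N) {W : ℝ} (hW0 : 0 < W) (hW : W < 1 / 2) :
    2 * bandIndex N W + 1 ≤ N := by
  have h : (bandIndex N W : ℝ) ≤ N * W := Nat.floor_le (by positivity)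
  have hN' : (0 : ℝ) < N := by exact_mod_cast hN
  have : (2 * bandIndex N W : ℝ) < N := by nlinarith
  have : 2 * bandIndex N W < N := by exact_mod_cast this
  omega

/-- With $K = \lfloor NW\rfloor$, the frequency indices are distinct and lie in the window $[-K,
N-K)$, so no two agree modulo $N$. -/
theorem fromCols_dft_orthonormal {N : ℕ} (hN : 0 < N) {W : ℝ} (hW0 : 0 < W) (hW : W < 1 / 2) :
    (Matrix.fromCols (lowDFT N W) (highDFT N W))ᴴ *
      Matrix.fromCols (lowDFT N W) (highDFT N W) = 1 := by
  have hK := lowDim_le hN hW0 hW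
  refine dft_orthonormal hN (l := Sum.elim (fun i : Fin (lowDim N W) => (i : ℤ) - bandIndex N W)
    (fun i : Fin (highDim N W) => bandIndex N W + 1 + (i : ℤ))) ?_ _ ?_
  · have key : ∀ i : Fin (lowDim N W) ⊕ Fin (highDim N W),
        -(bandIndex N W : ℤ) ≤ Sum.elim (fun i : Fin (lowDim N W) => (i : ℤ) - bandIndex N W)
          (fun i : Fin (highDim N W) => bandIndex N W + 1 + (i : ℤ)) i ∧
        Sum.elim (fun i : Fin (lowDim N W) => (i : ℤ) - bandIndex N W)
          (fun i : Fin (highDim N W) => bandIndex N W + 1 + (i : ℤ)) i < N - bandIndex N W := by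
      rintro (⟨i, hi⟩ | ⟨i, hi⟩)
      · simp only [Sum.elim_inl]; unfold lowDim at hi; omega
      · simp only [Sum.elim_inr]; unfold highDim at hi; omega
    intro i j hij
    refine ⟨?_, ?_⟩
    · rcases i with ⟨i, hi⟩ | ⟨i, hi⟩ <;> rcases j with ⟨j, hj⟩ | ⟨j, hj⟩ <;>
        simp only [Sum.elim_inl, Sum.elim_inr, ne_eq, Sum.inl.injEq, Sum.inr.injEq,
          Fin.mk.injEq] at hij ⊢ <;> unfold lowDim at * <;> omega
    · have h1 := key i
      have h2 := key j
      rw [abs_lt]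
      constructor <;> linarith
  · rintro n (i | i)
    · simp [Matrix.fromCols, lowDFT]
    · simp [Matrix.fromCols, highDFT]

theorem dft_blocks {N : ℕ} (hN : 0 < N) {W : ℝ} (hW0 : 0 < W) (hW : W < 1 / 2) :
    (lowDFT N W)ᴴ * lowDFT N W = 1 ∧ (lowDFT N W)ᴴ * highDFT N W = 0 ∧
    (highDFT N W)ᴴ * lowDFT N W = 0 ∧ (highDFT N W)ᴴ * highDFT N W = 1 := by
  have h := fromCols_dft_orthonormal hN hW0 hW
  rw [Matrix.conjTranspose_fromCols_eq_fromRows_conjTranspose, Matrix.fromRows_mul_fromCols,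
    ← Matrix.fromBlocks_one] at h
  exact Matrix.fromBlocks_inj.1 h

/-- The two column counts add up to $N$, so the left inverse of the joined matrix is also a right
inverse. -/
theorem dft_complete {N : ℕ} (hN : 0 < N) {W : ℝ} (hW0 : 0 < W) (hW : W < 1 / 2) :
    lowDFT N W * (lowDFT N W)ᴴ + highDFT N W * (highDFT N W)ᴴ = 1 := by
  have h := fromCols_dft_orthonormal hN hW0 hW
  rw [Matrix.mul_eq_one_comm_of_card_eq] at h
  · rwa [Matrix.conjTranspose_fromCols_eq_fromRows_conjTranspose,
      Matrix.fromCols_mul_fromRows] at h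
  · have := lowDim_le hN hW0 hW
    simp only [Fintype.card_sum, Fintype.card_fin]
    unfold lowDim highDim
    omega

theorem sum_norm_sq_highDFT_le {N : ℕ} (hN : 0 < N) {W : ℝ} (hW0 : 0 < W) (hW : W < 1 / 2)
    (v : Fin N → ℂ) :
    ∑ i, ‖((highDFT N W)ᴴ *ᵥ v) i‖ ^ 2 ≤ ∑ i, ‖v i‖ ^ 2 := by
  have h : star ((lowDFT N W)ᴴ *ᵥ v) ⬝ᵥ ((lowDFT N W)ᴴ *ᵥ v) +
      star ((highDFT N W)ᴴ *ᵥ v) ⬝ᵥ ((highDFT N W)ᴴ *ᵥ v) = star v ⬝ᵥ v := by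
    simp only [Matrix.star_mulVec, ← Matrix.dotProduct_mulVec, Matrix.mulVec_mulVec,
      Matrix.conjTranspose_conjTranspose]
    rw [← dotProduct_add, ← Matrix.add_mulVec, dft_complete hN hW0 hW, Matrix.one_mulVec]
  simp only [star_dotProduct_self] at h
  have h' : ∑ i, ‖((lowDFT N W)ᴴ *ᵥ v) i‖ ^ 2 + ∑ i, ‖((highDFT N W)ᴴ *ᵥ v) i‖ ^ 2 =
      ∑ i, ‖v i‖ ^ 2 := by exact_mod_cast h
  have : 0 ≤ ∑ i, ‖((lowDFT N W)ᴴ *ᵥ v) i‖ ^ 2 := by positivity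
  linarith

theorem basis_orthonormal {N : ℕ} (hN : 0 < N) {W : ℝ} (hW0 : 0 < W) (hW : W < 1 / 2)
    {r : ℕ} {V : Matrix (Fin (highDim N W)) (Fin r) ℂ} (hV : Vᴴ * V = 1) :
    (basis N W V)ᴴ * basis N W V = 1 := by
  obtain ⟨h1, h2, h3, h4⟩ := dft_blocks hN hW0 hW
  rw [basis, Matrix.conjTranspose_fromCols_eq_fromRows_conjTranspose, Matrix.fromRows_mul_fromCols,
    h1, ← Matrix.mul_assoc, h2, Matrix.conjTranspose_mul, Matrix.mul_assoc, h3, Matrix.mul_assoc,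
    ← Matrix.mul_assoc _ _ V, h4, Matrix.one_mul, hV, Matrix.zero_mul, Matrix.mul_zero,
    Matrix.fromBlocks_one]

/-- The low block cancels against the resolution of the identity; this moves the residual trace onto
$\overline F^*B$. -/
theorem one_sub_basis {N : ℕ} (hN : 0 < N) {W : ℝ} (hW0 : 0 < W) (hW : W < 1 / 2)
    {r : ℕ} {V : Matrix (Fin (highDim N W)) (Fin r) ℂ} :
    1 - basis N W V * (basis N W V)ᴴ =
    highDFT N W * (1 - V * Vᴴ) * (highDFT N W)ᴴ := by
  rw [basis, Matrix.conjTranspose_fromCols_eq_fromRows_conjTranspose, Matrix.fromCols_mul_fromRows,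
    ← dft_complete hN hW0 hW, Matrix.conjTranspose_mul]
  simp only [Matrix.mul_sub, Matrix.sub_mul, Matrix.mul_one, Matrix.mul_assoc]
  abel

end DFT

/-! ### Singular values: trace tails and min-max -/

section SVD

variable {m n : ℕ} {A : Matrix (Fin m) (Fin n) ℂ} {U : Matrix (Fin m) (Fin m) ℂ} {σ : ℕ → ℝ}
  {Y : Matrix (Fin n) (Fin n) ℂ}

theorem submatrix_castLE_orthonormal {r : ℕ} (h : r ≤ m)
    (hU : U ∈ Matrix.unitaryGroup (Fin m) ℂ) :
    (U.submatrix id (Fin.castLE h))ᴴ * U.submatrix id (Fin.castLE h) = 1 := by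
  have hU' : Uᴴ * U = 1 := (Matrix.mem_unitaryGroup_iff').1 hU
  rw [Matrix.conjTranspose_submatrix, ← Matrix.submatrix_mul _ _ _ _ _ Function.bijective_id, hU']
  exact Matrix.submatrix_one _ (Fin.castLE_injective h)

theorem one_sub_submatrix_castLE {r : ℕ} (h : r ≤ m)
    (hU : U ∈ Matrix.unitaryGroup (Fin m) ℂ) :
    1 - U.submatrix id (Fin.castLE h) * (U.submatrix id (Fin.castLE h))ᴴ =
      U * Matrix.diagonal (fun i : Fin m => if (i : ℕ) < r then (0 : ℂ) else 1) * Uᴴ := by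
  have h1 : U * Uᴴ = 1 := (Matrix.mem_unitaryGroup_iff).1 hU
  rw [sub_eq_iff_eq_add', ← h1]
  ext i j
  rw [Matrix.add_apply, Matrix.mul_apply, Matrix.mul_apply, Matrix.mul_apply]
  simp only [Matrix.submatrix_apply, Matrix.conjTranspose_apply, Matrix.mul_diagonal, id]
  have h2 : ∑ x : Fin r, U i (Fin.castLE h x) * star (U j (Fin.castLE h x)) =
      ∑ x : Fin m, if (x : ℕ) < r then U i x * star (U j x) else 0 := by
    rw [← Finset.sum_filter]
    refine Finset.sum_bij (fun x _ => Fin.castLE h x) (by simp) (by simp) ?_ (by simp)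
    intro b hb
    exact ⟨⟨b, by simpa using hb⟩, by simp, by ext; simp⟩
  rw [h2, ← Finset.sum_add_distrib]
  refine Finset.sum_congr rfl fun x _ => ?_
  split_ifs <;> simp

/-- The trace of the compression of `A * F` to the orthogonal complement of the dominant left
singular subspace is at most the sum of the remaining singular values. -/
theorem norm_trace_tail_le (hA : IsSVD A U σ Y) {F : Matrix (Fin n) (Fin m) ℂ} (hF : Fᴴ * F = 1)
    {r : ℕ} (h : r ≤ m) :
    ‖((1 - U.submatrix id (Fin.castLE h) * (U.submatrix id (Fin.castLE h))ᴴ) * A * F).trace‖ ≤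
      ∑ k ∈ Finset.Ico r m, σ k := by
  have hU' : Uᴴ * U = 1 := (Matrix.mem_unitaryGroup_iff').1 hA.left_unitary
  have hY : Y * Yᴴ = 1 := (Matrix.mem_unitaryGroup_iff).1 hA.right_unitary
  set D := Matrix.diagonal (fun i : Fin m => if (i : ℕ) < r then (0 : ℂ) else 1) with hD
  set S := Matrix.of fun (i : Fin m) (j : Fin n) =>
    if (i : ℕ) = (j : ℕ) then ((σ i : ℝ) : ℂ) else 0 with hS
  -- `G` has orthonormal columns, so its entries are at most 1 in modulus, and the trace becomes
  -- $\sum_{i\ge r}\sigma_i G_{ii}$.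
  set G := Yᴴ * F * U with hG
  have hGG : Gᴴ * G = 1 := by
    calc Gᴴ * G = Uᴴ * (Fᴴ * (Y * Yᴴ) * F) * U := by
          simp only [hG, Matrix.conjTranspose_mul, Matrix.conjTranspose_conjTranspose,
            Matrix.mul_assoc]
      _ = 1 := by rw [hY, Matrix.mul_one, hF, Matrix.mul_one, hU']
  have h1 : ((1 - U.submatrix id (Fin.castLE h) * (U.submatrix id (Fin.castLE h))ᴴ) *
      A * F).trace = (D * S * G).trace := by
    rw [one_sub_submatrix_castLE h hA.left_unitary, ← hD]
    have : A = U * S * Yᴴ := hA.eq_mul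
    rw [this]
    calc (U * D * Uᴴ * (U * S * Yᴴ) * F).trace
        = (U * (D * (Uᴴ * U) * S * Yᴴ * F)).trace := by simp only [Matrix.mul_assoc]
      _ = _ := by rw [hU', Matrix.mul_one, Matrix.trace_mul_comm, hG]; simp only [Matrix.mul_assoc]
  rw [h1, Matrix.trace]
  have h2 : ∀ i : Fin m, ‖(D * S * G).diag i‖ ≤ if (i : ℕ) < r then 0 else σ i := by
    intro i
    have h3 : (D * S * G).diag i =
        ∑ j : Fin n, (if (i : ℕ) < r then 0 else if (i : ℕ) = (j : ℕ) then (σ i : ℂ) * G j i else 0) := by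
      rw [Matrix.diag_apply, Matrix.mul_assoc, Matrix.diagonal_mul, Matrix.mul_apply,
        Finset.mul_sum]
      refine Finset.sum_congr rfl fun j _ => ?_
      simp only [hS, Matrix.of_apply]
      split_ifs <;> simp
    rw [h3]
    split_ifs with hi
    · simp
    · refine (norm_sum_le _ _).trans ?_
      calc ∑ j : Fin n, ‖if (i : ℕ) = (j : ℕ) then (σ i : ℂ) * G j i else 0‖
          ≤ ∑ j : Fin n, if (i : ℕ) = (j : ℕ) then σ i else 0 := by
            refine Finset.sum_le_sum fun j _ => ?_
            split_ifs
            · rw [norm_mul, Complex.norm_real, Real.norm_of_nonneg (hA.nonneg _)]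
              exact mul_le_of_le_one_right (hA.nonneg _) (norm_apply_le_one hGG j i)
            · simp
        _ = (Finset.univ.filter fun j : Fin n => (i : ℕ) = (j : ℕ)).card * σ i := by
            rw [← Finset.sum_filter, Finset.sum_const, nsmul_eq_mul]
        _ ≤ 1 * σ i := by
            refine mul_le_mul_of_nonneg_right ?_ (hA.nonneg _)
            have : (Finset.univ.filter fun j : Fin n => (i : ℕ) = (j : ℕ)).card ≤ 1 := by
              refine Finset.card_le_one.2 fun a ha b hb => ?_
              simp only [Finset.mem_filter, Finset.mem_univ, true_and] at ha hb
              exact Fin.ext (ha.symm.trans hb)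
            exact_mod_cast this
        _ = σ i := one_mul _
  refine (norm_sum_le _ _).trans ((Finset.sum_le_sum fun i _ => h2 i).trans_eq ?_)
  rw [Fin.sum_univ_eq_sum_range (fun i => if i < r then 0 else σ i) m,
    Finset.range_eq_Ico, ← Finset.sum_Ico_consecutive _ (Nat.zero_le r) h, Finset.sum_eq_zero,
    zero_add]
  · exact Finset.sum_congr rfl fun k hk => if_neg (not_lt.2 (Finset.mem_Ico.1 hk).1)
  · exact fun k hk => if_pos (Finset.mem_Ico.1 hk).2

/-- Lower half of the min-max principle: fewer than `k + 1` linear conditions cannot exclude all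
vectors that are stretched by `σ k`. -/
theorem IsSVD.exists_stretched (hA : IsSVD A U σ Y) {E : Type*} [AddCommGroup E] [Module ℂ E]
    [FiniteDimensional ℂ E] (T : (Fin n → ℂ) →ₗ[ℂ] E) {k : ℕ} (hkm : k < m) (hkn : k < n)
    (hk : Module.finrank ℂ E ≤ k) :
    ∃ x : Fin n → ℂ, 0 < ∑ i, ‖x i‖ ^ 2 ∧ T x = 0 ∧
      σ k ^ 2 * ∑ i, ‖x i‖ ^ 2 ≤ ∑ i, ‖(A *ᵥ x) i‖ ^ 2 := by
  have hYY : Yᴴ * Y = 1 := (Matrix.mem_unitaryGroup_iff').1 hA.right_unitary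
  have hUU : Uᴴ * U = 1 := (Matrix.mem_unitaryGroup_iff').1 hA.left_unitary
  set Z := Y.submatrix id (Fin.castLE (Nat.succ_le_of_lt hkn)) with hZ
  have hZZ : Zᴴ * Z = 1 := submatrix_castLE_orthonormal _ hA.right_unitary
  -- The first $k+1$ right singular vectors span one dimension more than `T` can detect, and `A`
  -- stretches that span by at least $\sigma_k$.
  have hker : LinearMap.ker (T ∘ₗ Z.mulVecLin) ≠ ⊥ := by
    apply LinearMap.ker_ne_bot_of_finrank_lt
    simp only [Module.finrank_fintype_fun_eq_card, Fintype.card_fin]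
    omega
  obtain ⟨c, hc, hc0⟩ := (Submodule.ne_bot_iff _).1 hker
  refine ⟨Z *ᵥ c, ?_, by simpa using hc, ?_⟩
  · rw [sum_norm_sq_mulVec hZZ]
    obtain ⟨i, hi⟩ := Function.ne_iff.1 hc0
    refine Finset.sum_pos' (fun i _ => by positivity) ⟨i, Finset.mem_univ _, ?_⟩
    have : 0 < ‖c i‖ := norm_pos_iff.2 hi
    positivity
  · rw [sum_norm_sq_mulVec hZZ]
    have h1 : Yᴴ * Z = (1 : Matrix (Fin n) (Fin n) ℂ).submatrix id
        (Fin.castLE (Nat.succ_le_of_lt hkn)) := by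
      rw [hZ, ← hYY]
      rfl
    have h2 : A *ᵥ (Z *ᵥ c) = U *ᵥ (((Matrix.of fun (i : Fin m) (j : Fin n) =>
        if (i : ℕ) = (j : ℕ) then ((σ i : ℝ) : ℂ) else 0) * (Yᴴ * Z)) *ᵥ c) := by
      conv_lhs => rw [hA.eq_mul]
      simp only [Matrix.mulVec_mulVec, Matrix.mul_assoc]
    rw [h2, sum_norm_sq_mulVec hUU, h1]
    have h3 : ∀ j : Fin (k + 1), (((Matrix.of fun (i : Fin m) (j : Fin n) =>
        if (i : ℕ) = (j : ℕ) then ((σ i : ℝ) : ℂ) else 0) *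
        (1 : Matrix (Fin n) (Fin n) ℂ).submatrix id (Fin.castLE (Nat.succ_le_of_lt hkn))) *ᵥ c)
        (Fin.castLE (Nat.succ_le_of_lt hkm) j) = σ j * c j := by
      intro j
      rw [← Matrix.submatrix_id_id (Matrix.of _),
        ← Matrix.submatrix_mul _ _ _ _ _ Function.bijective_id, Matrix.mul_one, Matrix.mulVec,
        dotProduct, Finset.sum_eq_single j]
      · simp
      · intro b _ hb
        have : (j : ℕ) ≠ b := fun h => hb (Fin.ext h.symm)
        simp [this]
      · simp
    generalize (((Matrix.of fun (i : Fin m) (j : Fin n) =>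
        if (i : ℕ) = (j : ℕ) then ((σ i : ℝ) : ℂ) else 0) *
        (1 : Matrix (Fin n) (Fin n) ℂ).submatrix id (Fin.castLE (Nat.succ_le_of_lt hkn))) *ᵥ c) = w
        at h3 ⊢
    calc σ k ^ 2 * ∑ i, ‖c i‖ ^ 2 ≤ ∑ j : Fin (k + 1), ‖(σ j : ℂ) * c j‖ ^ 2 := by
          rw [Finset.mul_sum]
          refine Finset.sum_le_sum fun j _ => ?_
          rw [norm_mul, mul_pow, Complex.norm_real, Real.norm_of_nonneg (hA.nonneg _)]
          have h4 : σ k ≤ σ j := hA.antitone (Nat.lt_succ_iff.1 j.2)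
          have := hA.nonneg k
          gcongr
      _ = ∑ j : Fin (k + 1), ‖w (Fin.castLE (Nat.succ_le_of_lt hkm) j)‖ ^ 2 :=
          Finset.sum_congr rfl fun j _ => by rw [← h3 j]
      _ = ∑ i ∈ Finset.univ.map (Fin.castLEEmb (Nat.succ_le_of_lt hkm)), ‖w i‖ ^ 2 :=
          (Finset.sum_map Finset.univ (Fin.castLEEmb (Nat.succ_le_of_lt hkm))
            (fun i => ‖w i‖ ^ 2)).symm
      _ ≤ _ := Finset.sum_le_sum_of_subset_of_nonneg (Finset.subset_univ _)
            (fun _ _ _ => by positivity)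

end SVD

/-! ### Integral and Lipschitz bound of the residual energy -/

section Residual

theorem continuous_sinusoid_apply (N : ℕ) (n : Fin N) : Continuous fun f => sinusoid N f n := by
  simp only [sinusoid_apply]
  fun_prop

theorem integral_sinusoid_sub (N : ℕ) (W : ℝ) (m n : Fin N) :
    ∫ f in (-W)..W, sinusoid N f m * star (sinusoid N f n) = prolate N W m n := by
  have h : ∀ f : ℝ, sinusoid N f m * star (sinusoid N f n) =
      Complex.exp ((2 * Real.pi * Complex.I * ((m : ℕ) - (n : ℕ) : ℂ)) * f) := fun f => by
    rw [star_sinusoid_apply, sinusoid_apply, sinusoid_apply, ← Complex.exp_add]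
    congr 1
    push_cast; ring
  simp only [h]
  rw [prolate, Matrix.of_apply]
  split_ifs with hmn
  · subst hmn
    simp [two_mul]
  · have h1 : ((m : ℕ) - (n : ℕ) : ℂ) ≠ 0 :=
      sub_ne_zero.2 fun h => hmn (Fin.ext (by exact_mod_cast h))
    have hpi : (Real.pi : ℂ) ≠ 0 := by exact_mod_cast Real.pi_ne_zero
    have h2 : (2 * Real.pi * Complex.I * ((m : ℕ) - (n : ℕ) : ℂ)) ≠ 0 :=
      mul_ne_zero Complex.two_pi_I_ne_zero h1
    rw [integral_exp_mul_complex h2]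
    push_cast
    rw [Complex.sin]
    have h3 : (2 * Real.pi * Complex.I * ((m : ℕ) - (n : ℕ) : ℂ)) * (W : ℂ) =
        2 * Real.pi * W * ((m : ℕ) - (n : ℕ)) * Complex.I := by ring
    have h4 : (2 * Real.pi * Complex.I * ((m : ℕ) - (n : ℕ) : ℂ)) * (-W : ℂ) =
        -(2 * Real.pi * W * ((m : ℕ) - (n : ℕ))) * Complex.I := by ring
    rw [h3, h4]
    field_simp
    rw [Complex.I_sq]
    ring

theorem integral_quadratic_form (N : ℕ) (W : ℝ) (P : Matrix (Fin N) (Fin N) ℂ) :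
    ∫ f in (-W)..W, star (sinusoid N f).ofLp ⬝ᵥ (P *ᵥ (sinusoid N f).ofLp) =
      (P * prolate N W).trace := by
  have hc := continuous_sinusoid_apply N
  simp only [dotProduct, Matrix.mulVec, Finset.mul_sum, Pi.star_apply]
  rw [intervalIntegral.integral_finsetSum]
  · rw [Matrix.trace]
    refine Finset.sum_congr rfl fun m _ => ?_
    rw [intervalIntegral.integral_finsetSum, Matrix.diag_apply, Matrix.mul_apply]
    · refine Finset.sum_congr rfl fun n _ => ?_
      rw [← integral_sinusoid_sub, ← intervalIntegral.integral_const_mul]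
      congr 1
      ext f
      ring
    · intro n _
      exact ((hc m).star.mul (continuous_const.mul (hc n))).intervalIntegrable _ _
  · intro m _
    exact (continuous_finsetSum _ fun n _ =>
      (hc m).star.mul (continuous_const.mul (hc n))).intervalIntegrable _ _

/-- For an orthogonal projection `P`, the residual energy integrates to a trace. -/
theorem integral_projection_energy (N : ℕ) (W : ℝ) {P : Matrix (Fin N) (Fin N) ℂ}
    (hP : Pᴴ = P) (hPP : P * P = P) :
    ((∫ f in (-W)..W, ∑ i, ‖(P *ᵥ (sinusoid N f).ofLp) i‖ ^ 2 : ℝ) : ℂ) =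
      (P * prolate N W).trace := by
  rw [← integral_quadratic_form, ← intervalIntegral.integral_ofReal]
  congr 1
  ext f
  rw [← star_dotProduct_self, Matrix.star_mulVec, ← Matrix.dotProduct_mulVec, Matrix.mulVec_mulVec,
    hP, hPP]

theorem norm_exp_sub_exp_le (a b : ℝ) :
    ‖Complex.exp (a * Complex.I) - Complex.exp (b * Complex.I)‖ ≤ |a - b| := by
  have h : Complex.exp (a * Complex.I) - Complex.exp (b * Complex.I) =
      Complex.exp (b * Complex.I) * (Complex.exp (Complex.I * ((a - b : ℝ) : ℂ)) - 1) := by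
    rw [mul_sub, ← Complex.exp_add, mul_one]
    congr 2
    push_cast; ring
  rw [h, norm_mul, Complex.norm_exp_ofReal_mul_I, one_mul]
  exact (Real.norm_exp_I_mul_ofReal_sub_one_le).trans_eq (Real.norm_eq_abs _)

/-- The sampled exponential with its phase referred to the midpoint of the sampling window. -/
noncomputable def centeredSinusoid (N : ℕ) (f : ℝ) : EuclideanSpace ℂ (Fin N) :=
  Complex.exp ((-(Real.pi * N * f) : ℝ) * Complex.I) • sinusoid N f

/-- After centering, the exponents carry $2n - N$, bounded by $N$ in absolute value; the uncentred
$2n$ would cost a factor 2. -/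
theorem norm_centeredSinusoid_sub_le (N : ℕ) (f g : ℝ) :
    ‖centeredSinusoid N f - centeredSinusoid N g‖ ≤ Real.sqrt N * (Real.pi * N * |f - g|) := by
  have h : ∀ n, ‖(centeredSinusoid N f - centeredSinusoid N g) n‖ ≤ Real.pi * N * |f - g| := by
    intro n
    have h1 : ∀ f : ℝ, centeredSinusoid N f n =
        Complex.exp ((Real.pi * (2 * (n : ℕ) - N) * f : ℝ) * Complex.I) := fun f => by
      rw [centeredSinusoid, PiLp.smul_apply, smul_eq_mul, sinusoid_apply, ← Complex.exp_add]
      congr 1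
      push_cast; ring
    rw [PiLp.sub_apply, h1, h1]
    refine (norm_exp_sub_exp_le _ _).trans ?_
    rw [← mul_sub, abs_mul, abs_mul, abs_of_pos Real.pi_pos]
    have h2 : |(2 * (n : ℕ) - N : ℝ)| ≤ N := by
      have h3 : ((n : ℕ) : ℝ) ≤ N := by exact_mod_cast n.2.le
      have h4 : (0 : ℝ) ≤ (n : ℕ) := by positivity
      rw [abs_le]
      constructor <;> linarith
    have := Real.pi_pos
    gcongr
  rw [EuclideanSpace.norm_eq]
  refine (Real.sqrt_le_sqrt (Finset.sum_le_sum fun n _ => pow_le_pow_left₀ (norm_nonneg _) (h n)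
    2)).trans_eq ?_
  have := Real.pi_pos
  rw [Finset.sum_const, Finset.card_univ, Fintype.card_fin, nsmul_eq_mul,
    Real.sqrt_mul (by positivity), Real.sqrt_sq (by positivity)]

variable {N : ℕ} {P : EuclideanSpace ℂ (Fin N) →ₗ[ℂ] EuclideanSpace ℂ (Fin N)}

/-- A unit phase does not change the residual norm, so the centered vectors may be used; factor the
difference of squares and bound each norm by $\sqrt N$. -/
theorem residual_lipschitz (hP : ∀ x, ‖P x‖ ≤ ‖x‖) (f g : ℝ) :
    ‖P (sinusoid N f)‖ ^ 2 - ‖P (sinusoid N g)‖ ^ 2 ≤ 2 * Real.pi * N ^ 2 * |f - g| := by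
  have h1 : ∀ f, ‖P (sinusoid N f)‖ = ‖P (centeredSinusoid N f)‖ := fun f => by
    rw [centeredSinusoid, map_smul, norm_smul, Complex.norm_exp_ofReal_mul_I, one_mul]
  have h2 : ∀ f, ‖P (sinusoid N f)‖ ≤ Real.sqrt N := fun f => by
    refine (hP _).trans_eq ?_
    rw [← norm_sq_sinusoid N f, Real.sqrt_sq (norm_nonneg _)]
  have h3 : ‖P (sinusoid N f)‖ - ‖P (sinusoid N g)‖ ≤ Real.sqrt N * (Real.pi * N * |f - g|) := by
    rw [h1, h1]
    refine (norm_sub_norm_le _ _).trans ?_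
    rw [← map_sub]
    exact (hP _).trans (norm_centeredSinusoid_sub_le N f g)
  have h4 : Real.sqrt N * Real.sqrt N = N := Real.mul_self_sqrt (Nat.cast_nonneg N)
  have h5 := norm_nonneg (P (sinusoid N f))
  have h6 := norm_nonneg (P (sinusoid N g))
  have h7 : 0 ≤ Real.sqrt N * (Real.pi * N * |f - g|) := by
    have := Real.pi_pos
    positivity
  calc ‖P (sinusoid N f)‖ ^ 2 - ‖P (sinusoid N g)‖ ^ 2
      = (‖P (sinusoid N f)‖ - ‖P (sinusoid N g)‖) * (‖P (sinusoid N f)‖ + ‖P (sinusoid N g)‖) := by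
        ring
    _ ≤ (Real.sqrt N * (Real.pi * N * |f - g|)) * (‖P (sinusoid N f)‖ + ‖P (sinusoid N g)‖) := by
        gcongr
    _ ≤ (Real.sqrt N * (Real.pi * N * |f - g|)) * (Real.sqrt N + Real.sqrt N) := by
        gcongr <;> exact h2 _
    _ = (Real.sqrt N * Real.sqrt N) * (2 * Real.pi * N * |f - g|) := by ring
    _ = _ := by rw [h4]; ring

end Residual

/-- A nonnegative function with one-sided Lipschitz constant `2 π N²` and small integral over
`[-W, W]` is pointwise small there. -/
theorem le_of_lipschitz_of_integral_le {g : ℝ → ℝ} {n W ε : ℝ} (hn : 0 < n) (hg0 : ∀ x, 0 ≤ g x)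
    (hgc : Continuous g) (hg : ∀ x y, g x - g y ≤ 2 * Real.pi * n ^ 2 * |x - y|)
    (hW : 1 / (4 * Real.pi * n) ≤ W) (hε0 : 0 < ε) (hε : ε ≤ 1 / 2)
    (hint : ∫ x in (-W)..W, g x ≤ ε ^ 2 / (4 * Real.pi)) {x : ℝ} (hx : x ∈ Set.Icc (-W) W) :
    g x ≤ n * ε := by
  by_contra! hlt
  have hpi := Real.pi_pos
  -- A ramp of height $n\epsilon$ and slope $2\pi n^2$ reaches zero after length `δ` and encloses
  -- area exactly $\epsilon^2/(4\pi)$.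
  set δ := ε / (2 * Real.pi * n) with hδ
  have hδ0 : 0 < δ := by positivity
  have hδW : δ ≤ W := by
    refine le_trans ?_ hW
    rw [hδ, div_le_div_iff₀ (by positivity) (by positivity)]
    nlinarith [mul_pos hpi hn]
  -- Only one side of `x` need fit in the band: go towards the origin, where there is room because
  -- $\delta \le W$.
  obtain ⟨a, ha, hb, hax⟩ : ∃ a, -W ≤ a ∧ a + δ ≤ W ∧ (a = x ∨ a + δ = x) := by
    rcases le_total x 0 with h | h
    · exact ⟨x, hx.1, by linarith, Or.inl rfl⟩
    · exact ⟨x - δ, by linarith, by linarith [hx.2], Or.inr (by ring)⟩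
  have hsub : ∫ y in a..(a + δ), g y ≤ ∫ y in (-W)..W, g y :=
    intervalIntegral.integral_mono_interval ha (by linarith) hb
      (Filter.Eventually.of_forall hg0) (hgc.intervalIntegrable _ _)
  have hlow : ∫ y in a..(a + δ), (g x - 2 * Real.pi * n ^ 2 * |x - y|) ≤
      ∫ y in a..(a + δ), g y := by
    refine intervalIntegral.integral_mono_on (by linarith)
      (Continuous.intervalIntegrable (by fun_prop) _ _) (hgc.intervalIntegrable _ _) fun y _ => ?_
    linarith [hg x y]
  have habs : ∫ y in a..(a + δ), |x - y| = δ ^ 2 / 2 := by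
    rcases hax with h | h
    · have h1 : ∫ y in a..(a + δ), |x - y| = ∫ y in a..(a + δ), (y - a) := by
        refine intervalIntegral.integral_congr fun y hy => ?_
        rw [Set.uIcc_of_le (by linarith)] at hy
        rw [abs_of_nonpos (by linarith [hy.1])]
        linarith
      rw [h1, intervalIntegral.integral_comp_sub_right (fun y => y) a]
      simp
    · have h1 : ∫ y in a..(a + δ), |x - y| = ∫ y in a..(a + δ), (a + δ - y) := by
        refine intervalIntegral.integral_congr fun y hy => ?_
        rw [Set.uIcc_of_le (by linarith)] at hy
        rw [abs_of_nonneg (by linarith [hy.2])]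
        linarith
      rw [h1, intervalIntegral.integral_comp_sub_left (fun y => y) (a + δ)]
      simp
  rw [intervalIntegral.integral_sub (Continuous.intervalIntegrable (by fun_prop) _ _)
    (Continuous.intervalIntegrable (by fun_prop) _ _), intervalIntegral.integral_const_mul, habs,
    intervalIntegral.integral_const] at hlow
  have h2 : (a + δ - a) • g x - 2 * Real.pi * n ^ 2 * (δ ^ 2 / 2) ≤ ε ^ 2 / (4 * Real.pi) :=
    hlow.trans (hsub.trans hint)
  rw [smul_eq_mul] at h2
  have h3 : (a + δ - a) * g x > δ * (n * ε) := by
    rw [add_sub_cancel_left]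
    exact mul_lt_mul_of_pos_left hlt hδ0
  have h4 : δ * (n * ε) - 2 * Real.pi * n ^ 2 * (δ ^ 2 / 2) = ε ^ 2 / (4 * Real.pi) := by
    rw [hδ]
    field_simp
    ring
  linarith

/-! ### Fourier multipliers on the band -/

section BandOperator

variable {N : ℕ} {W : ℝ} {ω : ℝ → ℂ}

/-- The discrete-time Fourier transform of a vector supported on `0, …, N - 1`. -/
noncomputable def dtft (N : ℕ) (x : Fin N → ℂ) (f : ℝ) : ℂ := ∑ n, star (sinusoid N f n) * x n

/-- Fourier multiplication by `ω` on the band `[-W, W]`, compressed to `0, …, N - 1`. -/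
noncomputable def bandMultiplier (N : ℕ) (W : ℝ) (ω : ℝ → ℂ) (x : Fin N → ℂ) : Fin N → ℂ :=
  fun m => ∫ f in (-W)..W, ω f * dtft N x f * sinusoid N f m

/-- The Dirichlet kernel `∑ exp (2πifn)`. -/
noncomputable def dirichlet (N : ℕ) (f : ℝ) : ℂ := ∑ n, sinusoid N f n

theorem continuous_dtft (x : Fin N → ℂ) : Continuous (dtft N x) :=
  continuous_finsetSum _ fun n _ => (continuous_sinusoid_apply N n).star.mul continuous_const

theorem continuous_dirichlet : Continuous (dirichlet N) :=
  continuous_finsetSum _ fun n _ => continuous_sinusoid_apply N n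

theorem intervalIntegrable_band (hW : 0 ≤ W) (hω : ContinuousOn ω (Set.Icc (-W) W)) :
    IntervalIntegrable ω MeasureTheory.volume (-W) W :=
  ContinuousOn.intervalIntegrable (by rwa [Set.uIcc_of_le (by linarith)])

theorem prolate_mulVec (x : Fin N → ℂ) : prolate N W *ᵥ x = bandMultiplier N W 1 x := by
  ext m
  simp only [Matrix.mulVec, dotProduct, bandMultiplier, dtft, Pi.one_apply, one_mul, Finset.sum_mul]
  rw [intervalIntegral.integral_finsetSum]
  · refine Finset.sum_congr rfl fun n _ => ?_
    rw [← integral_sinusoid_sub, ← intervalIntegral.integral_mul_const]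
    congr 1
    ext f
    ring
  · exact fun n _ => (((continuous_sinusoid_apply N n).star.mul continuous_const).mul
      (continuous_sinusoid_apply N m)).intervalIntegrable _ _

/-- Pairing with a multiplier moves to the frequency side. -/
theorem sum_mul_bandMultiplier (hW : 0 ≤ W) (hω : ContinuousOn ω (Set.Icc (-W) W))
    (x c : Fin N → ℂ) : ∑ m, c m * bandMultiplier N W ω x m =
      ∫ f in (-W)..W, ω f * dtft N x f * ∑ m, c m * sinusoid N f m := by
  simp only [bandMultiplier, Finset.mul_sum]
  rw [intervalIntegral.integral_finsetSum]
  · refine Finset.sum_congr rfl fun m _ => ?_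
    rw [← intervalIntegral.integral_const_mul]
    congr 1
    ext f
    ring
  · exact fun m _ => intervalIntegrable_band hW ((hω.mul (continuous_dtft x).continuousOn).mul
      (continuous_const.mul (continuous_sinusoid_apply N m)).continuousOn)

theorem star_dotProduct_bandMultiplier (hW : 0 ≤ W) (hω : ContinuousOn ω (Set.Icc (-W) W))
    (x y : Fin N → ℂ) : star y ⬝ᵥ bandMultiplier N W ω x =
      ∫ f in (-W)..W, ω f * dtft N x f * star (dtft N y f) := by
  rw [dotProduct, sum_mul_bandMultiplier hW hω]
  simp only [dtft, star_sum, star_mul', star_star, Pi.star_apply, mul_comm]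

/-- This is Plancherel: at full bandwidth the integral form of the prolate matrix is the identity.
-/
theorem prolate_one_half : prolate N (1 / 2) = 1 := by
  ext m n
  rw [prolate, Matrix.of_apply, Matrix.one_apply]
  split_ifs with h
  · norm_num
  · have : Real.sin (2 * Real.pi * (1 / 2) * ((m : ℝ) - (n : ℝ))) = 0 := by
      rw [Real.sin_eq_zero_iff]
      exact ⟨(m : ℤ) - n, by push_cast; ring⟩
    rw [this]
    simp

theorem integral_norm_dtft_sq_le (hW : 0 ≤ W) (hW' : W ≤ 1 / 2) (x : Fin N → ℂ) :
    ∫ f in (-W)..W, ‖dtft N x f‖ ^ 2 ≤ ∑ n, ‖x n‖ ^ 2 := by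
  have hc : Continuous fun f => ‖dtft N x f‖ ^ 2 := (continuous_dtft x).norm.pow 2
  have h1 : ∫ f in (-(1 / 2 : ℝ))..(1 / 2), ‖dtft N x f‖ ^ 2 = ∑ n, ‖x n‖ ^ 2 := by
    have h2 := star_dotProduct_bandMultiplier (N := N) (W := 1 / 2) (ω := 1) (by norm_num)
      continuousOn_const x x
    rw [← prolate_mulVec, prolate_one_half, Matrix.one_mulVec, star_dotProduct_self] at h2
    have h3 : ∀ f, (1 : ℝ → ℂ) f * dtft N x f * star (dtft N x f) = ((‖dtft N x f‖ ^ 2 : ℝ) : ℂ) :=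
      fun f => by
        have := Complex.mul_conj' (dtft N x f)
        simpa using this
    simp only [h3] at h2
    rw [intervalIntegral.integral_ofReal] at h2
    exact_mod_cast h2.symm
  rw [← h1]
  exact intervalIntegral.integral_mono_interval (by linarith) (by linarith) hW'
    (Filter.Eventually.of_forall fun f => by positivity) (hc.intervalIntegrable _ _)

/-- A multiplier bounded by `M` has operator norm at most `M`. -/
theorem sum_norm_sq_bandMultiplier_le (hW : 0 ≤ W) (hW' : W ≤ 1 / 2)
    (hω : ContinuousOn ω (Set.Icc (-W) W)) {M : ℝ}
    (hωM : ∀ f ∈ Set.Icc (-W) W, ‖ω f‖ ≤ M) (x : Fin N → ℂ) :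
    ∑ m, ‖bandMultiplier N W ω x m‖ ^ 2 ≤ M ^ 2 * ∑ n, ‖x n‖ ^ 2 := by
  set y := bandMultiplier N W ω x with hy
  have h1 := star_dotProduct_bandMultiplier hW hω x y
  rw [← hy, star_dotProduct_self] at h1
  have hcx : Continuous fun f => ‖dtft N x f‖ ^ 2 := (continuous_dtft x).norm.pow 2
  have hcy : Continuous fun f => ‖dtft N y f‖ ^ 2 := (continuous_dtft y).norm.pow 2
  -- Pair `y` with itself on the frequency side and apply AM-GM; half of the energy of `y` is
  -- absorbed on the left at the end.
  have h2 : ∑ m, ‖y m‖ ^ 2 ≤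
      ∫ f in (-W)..W, (M ^ 2 / 2 * ‖dtft N x f‖ ^ 2 + 1 / 2 * ‖dtft N y f‖ ^ 2) := by
    have h3 : ∑ m, ‖y m‖ ^ 2 = ‖((∑ m, ‖y m‖ ^ 2 : ℝ) : ℂ)‖ := by
      rw [Complex.norm_real, Real.norm_of_nonneg (by positivity)]
    rw [h3, h1]
    refine (intervalIntegral.norm_integral_le_integral_norm (by linarith)).trans ?_
    refine intervalIntegral.integral_mono_on (by linarith) ?_ ?_ fun f hf => ?_
    · exact (intervalIntegrable_band hW ((hω.mul (continuous_dtft x).continuousOn).mul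
        (continuous_dtft y).star.continuousOn)).norm
    · exact ((continuous_const.mul hcx).add (continuous_const.mul hcy)).intervalIntegrable _ _
    · rw [norm_mul, norm_mul, norm_star]
      have h4 : ‖ω f‖ * ‖dtft N x f‖ * ‖dtft N y f‖ ≤ M * ‖dtft N x f‖ * ‖dtft N y f‖ := by
        gcongr
        exact hωM f hf
      nlinarith [sq_nonneg (M * ‖dtft N x f‖ - ‖dtft N y f‖)]
  rw [intervalIntegral.integral_add (Continuous.intervalIntegrable (by fun_prop) _ _)
    (Continuous.intervalIntegrable (by fun_prop) _ _), intervalIntegral.integral_const_mul,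
    intervalIntegral.integral_const_mul] at h2
  have h5 := integral_norm_dtft_sq_le hW hW' x
  have h6 := integral_norm_dtft_sq_le hW hW' y
  have h7 := mul_le_mul_of_nonneg_left h5 (sq_nonneg M)
  linarith

theorem highDFT_mulVec_bandMultiplier (hW : 0 ≤ W) (hω : ContinuousOn ω (Set.Icc (-W) W))
    (x : Fin N → ℂ) (i : Fin (highDim N W)) :
    ((highDFT N W)ᴴ *ᵥ bandMultiplier N W ω x) i = ((1 / Real.sqrt N : ℝ) : ℂ) *
      ∫ f in (-W)..W, ω f * dtft N x f *
        dirichlet N (f - ((bandIndex N W : ℝ) + 1 + ((i : ℕ) : ℝ)) / (N : ℝ)) := by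
  rw [Matrix.mulVec, dotProduct, sum_mul_bandMultiplier hW hω,
    ← intervalIntegral.integral_const_mul]
  congr 1
  ext f
  have h : ∑ m, (highDFT N W)ᴴ i m * sinusoid N f m = ((1 / Real.sqrt N : ℝ) : ℂ) *
      dirichlet N (f - ((bandIndex N W : ℝ) + 1 + ((i : ℕ) : ℝ)) / (N : ℝ)) := by
    unfold dirichlet
    rw [Finset.mul_sum]
    refine Finset.sum_congr rfl fun n _ => ?_
    rw [Matrix.conjTranspose_apply, highDFT, Matrix.of_apply, star_mul', star_sinusoid_apply,
      mul_assoc, sinusoid_apply_mul]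
    congr 1
    · exact Complex.conj_ofReal _
    · exact congrArg (fun z => sinusoid N z n) (by ring)
  rw [h]
  ring

end BandOperator

/-! ### Cauchy-like structure of the Dirichlet kernel -/

section Displacement

variable {N : ℕ} {W : ℝ} {ω : ℝ → ℂ}

/-- The factor of the Dirichlet kernel that does not depend on the DFT frequency. -/
noncomputable def kernelFactor (N : ℕ) (f : ℝ) : ℂ :=
  Complex.exp (-(Real.pi * f : ℝ) * Complex.I) *
    (Complex.exp (2 * Real.pi * Complex.I * (N * f)) - 1)

theorem continuous_kernelFactor : Continuous (kernelFactor N) := by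
  unfold kernelFactor
  fun_prop

/-- Integrality of $Ng$ removes $g$ from the numerator of the geometric sum; the denominator is a
sine up to phases that split between $f$ and $g$. -/
theorem dirichlet_mul_sin {g : ℝ} (hg : ∃ l : ℤ, N * g = l) (f : ℝ) :
    dirichlet N (f - g) * (Real.sin (Real.pi * (f - g)) : ℂ) =
      kernelFactor N f * (Complex.exp ((Real.pi * g : ℝ) * Complex.I) / (2 * Complex.I)) := by
  obtain ⟨l, hl⟩ := hg
  have h1 : Complex.exp (2 * Real.pi * Complex.I * (N * ((f - g : ℝ) : ℂ))) =
      Complex.exp (2 * Real.pi * Complex.I * (N * f)) := by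
    rw [Complex.exp_eq_exp_iff_exists_int]
    refine ⟨-l, ?_⟩
    have hl' : (N : ℂ) * g = l := by exact_mod_cast congrArg (fun z : ℝ => (z : ℂ)) hl
    push_cast
    rw [← hl']
    ring
  have h2 := sum_sinusoid_mul N (f - g)
  rw [h1] at h2
  have h3 : Complex.exp (2 * Real.pi * Complex.I * ((f - g : ℝ) : ℂ)) - 1 =
      Complex.exp ((Real.pi * f : ℝ) * Complex.I) *
        Complex.exp (-((Real.pi * g : ℝ)) * Complex.I) *
        (2 * Complex.I * (Real.sin (Real.pi * (f - g)) : ℂ)) := by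
    rw [← Complex.exp_add, Complex.ofReal_sin, Complex.sin]
    have e1 : Complex.exp (2 * Real.pi * Complex.I * ((f - g : ℝ) : ℂ)) =
        Complex.exp ((Real.pi * f : ℝ) * Complex.I + -(Real.pi * g : ℝ) * Complex.I) *
        Complex.exp ((Real.pi * (f - g) : ℝ) * Complex.I) := by
      rw [← Complex.exp_add]
      congr 1
      push_cast; ring
    have e2 : Complex.exp ((Real.pi * f : ℝ) * Complex.I + -(Real.pi * g : ℝ) * Complex.I) *
        Complex.exp (-(Real.pi * (f - g) : ℝ) * Complex.I) = 1 := by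
      rw [← Complex.exp_add, Complex.exp_eq_one_iff]
      exact ⟨0, by push_cast; ring⟩
    rw [e1]
    generalize Complex.exp ((Real.pi * f : ℝ) * Complex.I + -(Real.pi * g : ℝ) * Complex.I) = P
      at e2 ⊢
    generalize Complex.exp (-(Real.pi * (f - g) : ℝ) * Complex.I) = Y at e2 ⊢
    generalize Complex.exp ((Real.pi * (f - g) : ℝ) * Complex.I) = X
    linear_combination e2 + P * (X - Y) * Complex.I_sq
  rw [h3] at h2
  have h4 : Complex.exp (-(Real.pi * f : ℝ) * Complex.I) *
      Complex.exp ((Real.pi * f : ℝ) * Complex.I) = 1 := by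
    rw [← Complex.exp_add, Complex.exp_eq_one_iff]
    exact ⟨0, by push_cast; ring⟩
  have h5 : Complex.exp ((Real.pi * g : ℝ) * Complex.I) *
      Complex.exp (-(Real.pi * g : ℝ) * Complex.I) = 1 := by
    rw [← Complex.exp_add, Complex.exp_eq_one_iff]
    exact ⟨0, by push_cast; ring⟩
  rw [kernelFactor, ← h2]
  unfold dirichlet
  generalize Complex.exp (-(Real.pi * f : ℝ) * Complex.I) = a at h4 ⊢
  generalize Complex.exp ((Real.pi * f : ℝ) * Complex.I) = b at h4 ⊢
  generalize Complex.exp ((Real.pi * g : ℝ) * Complex.I) = c at h5 ⊢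
  generalize Complex.exp (-(Real.pi * g : ℝ) * Complex.I) = d at h5 ⊢
  generalize (∑ n, sinusoid N (f - g) n) = S
  generalize (Real.sin (Real.pi * (f - g)) : ℂ) = t
  have hI : (2 * Complex.I : ℂ) ≠ 0 := by simp
  have h6 : a * (S * (b * d * (2 * Complex.I * t))) * (c / (2 * Complex.I)) =
      S * t * ((a * b) * (c * d)) := by
    field_simp
  rw [h6, h4, h5]
  ring

/-- The trigonometric form `a cos πf + b sin πf`. -/
noncomputable def trigForm (c : ℝ × ℝ) (f : ℝ) : ℝ :=
  c.1 * Real.cos (Real.pi * f) + c.2 * Real.sin (Real.pi * f)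

theorem continuous_trigForm (c : ℝ × ℝ) : Continuous (trigForm c) := by
  unfold trigForm
  fun_prop

theorem trigForm_mul_sub (p q : ℝ × ℝ) (f g : ℝ) :
    trigForm p f * trigForm q g - trigForm p g * trigForm q f =
      -(p.1 * q.2 - p.2 * q.1) * Real.sin (Real.pi * (f - g)) := by
  simp only [trigForm, mul_sub, Real.sin_sub]
  ring

/-- One step of rational interpolation: multiplying the density by `p / q` multiplies its Cauchy
transform at a DFT frequency by the value there, provided a single moment vanishes. -/
theorem integral_trigForm_ratio (hW : 0 ≤ W) (hω : ContinuousOn ω (Set.Icc (-W) W)) (p q : ℝ × ℝ)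
    (hq : ∀ f ∈ Set.Icc (-W) W, trigForm q f ≠ 0)
    (h0 : ∫ f in (-W)..W, kernelFactor N f / trigForm q f * ω f = 0)
    {g : ℝ} (hg : ∃ l : ℤ, N * g = l) :
    (trigForm q g : ℂ) * ∫ f in (-W)..W, ((trigForm p f / trigForm q f : ℝ) : ℂ) * ω f *
        dirichlet N (f - g) =
      trigForm p g * ∫ f in (-W)..W, ω f * dirichlet N (f - g) := by
  have hD : ContinuousOn (fun f => dirichlet N (f - g)) (Set.Icc (-W) W) :=
    (continuous_dirichlet.comp (continuous_id.sub continuous_const)).continuousOn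
  have hr : ContinuousOn (fun f => ((trigForm p f / trigForm q f : ℝ) : ℂ)) (Set.Icc (-W) W) :=
    Complex.continuous_ofReal.comp_continuousOn
      ((continuous_trigForm p).continuousOn.div (continuous_trigForm q).continuousOn hq)
  rw [← intervalIntegral.integral_const_mul, ← intervalIntegral.integral_const_mul, ← sub_eq_zero,
    ← intervalIntegral.integral_sub]
  -- The antisymmetric combination of `p` and `q` is a multiple of $\sin\pi(f-g)$, which cancels the
  -- Cauchy denominator. What is left has rank one: a factor in $g$ times the vanishing moment.
  · have h1 : ∫ f in (-W)..W, ((trigForm q g : ℂ) * (((trigForm p f / trigForm q f : ℝ) : ℂ) * ω f *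
        dirichlet N (f - g)) - trigForm p g * (ω f * dirichlet N (f - g))) =
        ∫ f in (-W)..W, (-((p.1 * q.2 - p.2 * q.1 : ℝ) : ℂ) *
          (Complex.exp ((Real.pi * g : ℝ) * Complex.I) / (2 * Complex.I))) *
          (kernelFactor N f / trigForm q f * ω f) := by
      refine intervalIntegral.integral_congr fun f hf => ?_
      rw [Set.uIcc_of_le (by linarith)] at hf
      have hqf : (trigForm q f : ℂ) ≠ 0 := by exact_mod_cast hq f hf
      have h2 := dirichlet_mul_sin hg f
      have h3 : (trigForm p f * trigForm q g - trigForm p g * trigForm q f : ℂ) =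
          -((p.1 * q.2 - p.2 * q.1 : ℝ) : ℂ) * (Real.sin (Real.pi * (f - g)) : ℂ) := by
        exact_mod_cast congrArg (fun z : ℝ => (z : ℂ)) (trigForm_mul_sub p q f g)
      change (trigForm q g : ℂ) * (((trigForm p f / trigForm q f : ℝ) : ℂ) * ω f *
        dirichlet N (f - g)) - trigForm p g * (ω f * dirichlet N (f - g)) = _
      calc _ = (trigForm p f * trigForm q g - trigForm p g * trigForm q f : ℂ) *
            dirichlet N (f - g) * ω f / trigForm q f := by
            push_cast
            field_simp
        _ = -((p.1 * q.2 - p.2 * q.1 : ℝ) : ℂ) * (dirichlet N (f - g) *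
            (Real.sin (Real.pi * (f - g)) : ℂ)) * ω f / trigForm q f := by
            rw [h3]; ring
        _ = _ := by rw [h2]; ring
    rw [h1, intervalIntegral.integral_const_mul, h0, mul_zero]
  · exact intervalIntegrable_band hW (continuousOn_const.mul ((hr.mul hω).mul hD))
  · exact intervalIntegrable_band hW (continuousOn_const.mul (hω.mul hD))

/-- The functional `x ↦ ∫ ω(f) x̂(f) df` on the band. -/
noncomputable def bandFunctional (N : ℕ) (W : ℝ) (ω : ℝ → ℂ) : (Fin N → ℂ) →ₗ[ℂ] ℂ :=
  ∑ n, (∫ f in (-W)..W, ω f * star (sinusoid N f n)) • LinearMap.proj n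

theorem bandFunctional_apply (hW : 0 ≤ W) (hω : ContinuousOn ω (Set.Icc (-W) W))
    (x : Fin N → ℂ) : bandFunctional N W ω x = ∫ f in (-W)..W, ω f * dtft N x f := by
  simp only [bandFunctional, dtft, Finset.mul_sum, LinearMap.sum_apply, LinearMap.smul_apply,
    LinearMap.proj_apply, smul_eq_mul]
  rw [intervalIntegral.integral_finsetSum]
  · refine Finset.sum_congr rfl fun n _ => ?_
    rw [← intervalIntegral.integral_mul_const]
    congr 1
    ext f
    ring
  · exact fun n _ => intervalIntegrable_band hW (hω.mul
      ((continuous_sinusoid_apply N n).star.mul continuous_const).continuousOn)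

/-- Product of the first `n` ratios `pᵢ / qᵢ`. -/
noncomputable def trigRatio (p q : ℕ → ℝ × ℝ) (n : ℕ) (f : ℝ) : ℝ :=
  ∏ i ∈ Finset.range n, trigForm (p i) f / trigForm (q i) f

theorem continuousOn_trigRatio {p q : ℕ → ℝ × ℝ} {s : Set ℝ}
    (hq : ∀ i, ∀ f ∈ s, trigForm (q i) f ≠ 0) (n : ℕ) : ContinuousOn (trigRatio p q n) s :=
  continuousOn_finsetProd _ fun i _ =>
    (continuous_trigForm _).continuousOn.div (continuous_trigForm _).continuousOn (hq i)

/-- Functional $i$ is the moment required for the density already multiplied by the first $i$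
ratios, so `integral_trigForm_ratio` iterates. The identity stays cross-multiplied because the
denominators may vanish at $g$. -/
theorem exists_functionals_trigRatio (hW : 0 ≤ W) (p q : ℕ → ℝ × ℝ)
    (hq : ∀ i, ∀ f ∈ Set.Icc (-W) W, trigForm (q i) f ≠ 0) (n : ℕ) :
    ∃ T : (Fin N → ℂ) →ₗ[ℂ] (Fin n → ℂ), ∀ x, T x = 0 → ∀ g : ℝ, (∃ l : ℤ, N * g = l) →
      ((∏ i ∈ Finset.range n, trigForm (q i) g : ℝ) : ℂ) *
        ∫ f in (-W)..W, (trigRatio p q n f : ℂ) * dtft N x f * dirichlet N (f - g) =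
      ((∏ i ∈ Finset.range n, trigForm (p i) g : ℝ) : ℂ) *
        ∫ f in (-W)..W, dtft N x f * dirichlet N (f - g) := by
  have hcR : ∀ i, ContinuousOn (fun f => (trigRatio p q i f : ℂ)) (Set.Icc (-W) W) := fun i =>
    Complex.continuous_ofReal.comp_continuousOn (continuousOn_trigRatio hq i)
  refine ⟨LinearMap.pi fun i => bandFunctional N W
    (fun f => kernelFactor N f / trigForm (q i) f * (trigRatio p q i f : ℂ)), ?_⟩
  intro x hx g hg
  have hx' : ∀ i < n, ∫ f in (-W)..W, kernelFactor N f / trigForm (q i) f *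
      ((trigRatio p q i f : ℂ) * dtft N x f) = 0 := fun i hi => by
    have h1 := congrFun hx ⟨i, hi⟩
    rw [LinearMap.pi_apply, bandFunctional_apply hW] at h1
    · simpa only [mul_assoc, Pi.zero_apply] using h1
    · refine (continuous_kernelFactor.continuousOn.div
        (Complex.continuous_ofReal.comp (continuous_trigForm _)).continuousOn ?_).mul (hcR i)
      intro f hf
      simpa using hq i f hf
  suffices h : ∀ k ≤ n, ((∏ i ∈ Finset.range k, trigForm (q i) g : ℝ) : ℂ) *
        ∫ f in (-W)..W, (trigRatio p q k f : ℂ) * dtft N x f * dirichlet N (f - g) =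
      ((∏ i ∈ Finset.range k, trigForm (p i) g : ℝ) : ℂ) *
        ∫ f in (-W)..W, dtft N x f * dirichlet N (f - g) from h n le_rfl
  intro k
  induction k with
  | zero => intro _; simp [trigRatio]
  | succ k ih =>
    intro hk
    have h1 := integral_trigForm_ratio (ω := fun f => (trigRatio p q k f : ℂ) * dtft N x f) hW
      ((hcR k).mul (continuous_dtft x).continuousOn) (p k) (q k) (hq k) (hx' k hk) hg
    have h2 : ∀ f, (trigRatio p q (k + 1) f : ℂ) * dtft N x f * dirichlet N (f - g) =
        ((trigForm (p k) f / trigForm (q k) f : ℝ) : ℂ) *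
          ((trigRatio p q k f : ℂ) * dtft N x f) * dirichlet N (f - g) := fun f => by
      rw [trigRatio, Finset.prod_range_succ, Complex.ofReal_mul, ← trigRatio]
      ring
    simp only [h2]
    rw [Finset.prod_range_succ, Finset.prod_range_succ, Complex.ofReal_mul, Complex.ofReal_mul,
      mul_assoc, h1, mul_left_comm, ih (by omega)]
    ring

end Displacement

/-! ### Products over geometric shifts -/

section GeometricShifts

theorem abs_sub_div_add_le_one {u s : ℝ} (hu : 0 < u) (hs : 0 < s) : |(u - s) / (u + s)| ≤ 1 := by
  rw [abs_div, abs_of_pos (add_pos hu hs), div_le_one (add_pos hu hs), abs_le]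
  constructor <;> linarith

/-- The maximum is at $u = 3s$; after clearing denominators the slack is $5(u-3s)^2$. -/
theorem abs_two_factors_le {u s : ℝ} (hs : 0 < s) (h1 : s ≤ u) (h2 : u ≤ 9 * s) :
    |(u - s) / (u + s)| * |(u - 9 * s) / (u + 9 * s)| ≤ 1 / 4 := by
  rw [abs_div, abs_div, abs_of_nonneg (by linarith : 0 ≤ u - s),
    abs_of_nonpos (by linarith : u - 9 * s ≤ 0), abs_of_pos (by linarith : 0 < u + s),
    abs_of_pos (by linarith : 0 < u + 9 * s), div_mul_div_comm, div_le_div_iff₀ (by nlinarith)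
    (by norm_num)]
  nlinarith [sq_nonneg (u - 3 * s)]

/-- Shifts in geometric progression with ratio `9` contract by `1/4` on the interval they span. -/
theorem prod_geometric_shifts_le {s u : ℝ} (hs : 0 < s) (n : ℕ) (h1 : s ≤ u)
    (h2 : u ≤ 9 ^ (n + 1) * s) :
    ∏ i ∈ Finset.range (n + 2), |(u - 9 ^ i * s) / (u + 9 ^ i * s)| ≤ 1 / 4 := by
  have hu : 0 < u := hs.trans_le h1
  have hle : ∀ i : ℕ, |(u - 9 ^ i * s) / (u + 9 ^ i * s)| ≤ 1 := fun i =>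
    abs_sub_div_add_le_one hu (by positivity)
  induction n with
  | zero =>
    have := abs_two_factors_le hs h1 (by simpa using h2)
    simpa [Finset.prod_range_succ] using this
  | succ n ih =>
    rw [Finset.prod_range_succ]
    -- Either the new factor, at most 1, is discarded, or `u` lies between the last two shifts and
    -- those two alone suffice.
    by_cases h : u ≤ 9 ^ (n + 1) * s
    · exact (mul_le_of_le_one_right (Finset.prod_nonneg fun i _ => abs_nonneg _) (hle _)).trans
        (ih h)
    · have h3 : (9 : ℝ) ^ (n + 2) * s = 9 * (9 ^ (n + 1) * s) := by ring
      have h4 := abs_two_factors_le (u := u) (s := 9 ^ (n + 1) * s) (by positivity)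
        (le_of_not_ge h) (by rw [← h3]; exact h2)
      rw [Finset.prod_range_succ, mul_assoc, h3]
      exact (mul_le_of_le_one_left (by positivity)
        (Finset.prod_le_one (fun i _ => abs_nonneg _) fun i _ => hle i)).trans h4

theorem prod_range_mul_mod {M : Type*} [CommMonoid M] (F : ℕ → M) (p m : ℕ) :
    ∏ i ∈ Finset.range (p * m), F (i % p) = (∏ i ∈ Finset.range p, F i) ^ m := by
  induction m with
  | zero => simp
  | succ m ih =>
    rw [Nat.mul_succ, Finset.prod_range_add, ih, pow_succ]
    congr 1
    refine Finset.prod_congr rfl fun i hi => ?_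
    rw [Nat.mul_add_mod, Nat.mod_eq_of_lt (Finset.mem_range.1 hi)]

/-- The shift parameters `9 ^ i / (2 N)`, repeated with period `p`. -/
noncomputable def shift (N p i : ℕ) : ℝ := 9 ^ (i % p) * (1 / (2 * N))

theorem shift_pos {N : ℕ} (hN : 0 < N) (p i : ℕ) : 0 < shift N p i := by
  have : (0 : ℝ) < N := by exact_mod_cast hN
  unfold shift
  positivity

/-- The bound on $y$ puts $(1+y)/(1-y)$ in $[1/(2N), 2N]$. One period of shifts covers this since
$9^{p-1} \ge (2N)^2$, and each of the $m$ periods gains $1/4$. -/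
theorem prod_shift_le {N p : ℕ} (hN : 0 < N) (hp : 2 ≤ p) (hpN : 2 * N ≤ 3 ^ (p - 1)) (m : ℕ)
    {y : ℝ} (hy : |y| ≤ 1 - 1 / N) :
    ∏ i ∈ Finset.range (p * m), |((1 + y) / (1 - y) - shift N p i) /
      ((1 + y) / (1 - y) + shift N p i)| ≤ (1 / 4) ^ m := by
  have hN' : (0 : ℝ) < N := by exact_mod_cast hN
  have hn : 0 < 1 / (N : ℝ) := by positivity
  obtain ⟨hy1, hy2⟩ := abs_le.1 hy
  have hy3 : 0 < 1 - y := by linarith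
  obtain ⟨n, rfl⟩ : ∃ n, p = n + 2 := ⟨p - 2, by omega⟩
  have h1 : 1 / (2 * (N : ℝ)) ≤ (1 + y) / (1 - y) := by
    have e : 1 / (2 * (N : ℝ)) = 1 / N / 2 := by ring
    rw [e, div_le_div_iff₀ (by norm_num) hy3]
    nlinarith
  have h2 : (1 + y) / (1 - y) ≤ 2 * N := by
    rw [div_le_iff₀ hy3]
    have : (N : ℝ) * (1 / N) = 1 := by field_simp
    nlinarith
  have h3 : 2 * (N : ℝ) ≤ 3 ^ (n + 1) := by exact_mod_cast hpN
  have h4 : (1 + y) / (1 - y) ≤ 9 ^ (n + 1) * (1 / (2 * (N : ℝ))) := by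
    refine h2.trans ?_
    rw [mul_one_div, le_div_iff₀ (by positivity), show (9 : ℝ) = 3 * 3 by norm_num, mul_pow]
    gcongr
  have h5 := prod_geometric_shifts_le (by positivity) n h1 h4
  unfold shift
  rw [prod_range_mul_mod (fun i => |((1 + y) / (1 - y) - 9 ^ i * (1 / (2 * (N : ℝ)))) /
      ((1 + y) / (1 - y) + 9 ^ i * (1 / (2 * (N : ℝ))))|)]
  exact pow_le_pow_left₀ (Finset.prod_nonneg fun i _ => abs_nonneg _) h5 m

end GeometricShifts

/-! ### Separating the band from the high frequencies -/

section Separation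

/-- A scale balancing the band `[-W, W]` against the complementary band `[W', 1 - W']`. -/
theorem exists_balancing_scale {N : ℕ} (hN : 0 < N) {W W' : ℝ} (hW : 0 < W)
    (hWW : W + 1 / N ≤ W') (hW' : W' < 1 / 2) :
    ∃ τ : ℝ, 0 < τ ∧
      (∀ f ∈ Set.Icc (-W) W, 0 < Real.cos (Real.pi * f) ∧
        |Real.sin (Real.pi * f)| ≤ (1 - 1 / N) * (τ * Real.cos (Real.pi * f))) ∧
      (∀ g ∈ Set.Icc W' (1 - W'), 0 < Real.sin (Real.pi * g) ∧
        τ * |Real.cos (Real.pi * g)| ≤ (1 - 1 / N) * Real.sin (Real.pi * g)) := by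
  have hN' : (0 : ℝ) < N := by exact_mod_cast hN
  have hn : 0 < 1 / (N : ℝ) := by positivity
  have hpi := Real.pi_pos
  have hn1 : 0 ≤ 1 - 1 / (N : ℝ) := by linarith
  have aW : 0 < Real.pi * W := by positivity
  have aN : 0 < Real.pi * (1 / N) := by positivity
  have aWW : Real.pi * (W + 1 / N) ≤ Real.pi * W' := by gcongr
  have aW' : Real.pi * W' < Real.pi * (1 / 2) := by gcongr
  have hcW : 0 < Real.cos (Real.pi * W) :=
    Real.cos_pos_of_mem_Ioo ⟨by linarith, by linarith⟩
  have hsW : 0 < Real.sin (Real.pi * W) :=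
    Real.sin_pos_of_pos_of_lt_pi (by positivity) (by linarith)
  have hcW' : 0 < Real.cos (Real.pi * W') :=
    Real.cos_pos_of_mem_Ioo ⟨by linarith, by linarith⟩
  have hsW' : 0 < Real.sin (Real.pi * W') :=
    Real.sin_pos_of_pos_of_lt_pi (by linarith) (by linarith)
  set X := Real.sin (Real.pi * W) / Real.cos (Real.pi * W) with hX
  set T := Real.sin (Real.pi * W') / Real.cos (Real.pi * W') with hT
  have hX0 : 0 < X := div_pos hsW hcW
  have hT0 : 0 < T := div_pos hsW' hcW'
  -- Jordan's inequality $\sin x \ge 2x/\pi$ turns the frequency gap $1/N$ into a gap between the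
  -- tangents `X` and `T`.
  have hgap : 2 / (N : ℝ) ≤ Real.sin (Real.pi * W' - Real.pi * W) := by
    have h1 : Real.pi * (1 / N) ≤ Real.pi * W' - Real.pi * W := by linarith
    have h2 := Real.mul_le_sin (x := Real.pi * W' - Real.pi * W) (by linarith) (by linarith)
    refine le_trans ?_ h2
    calc 2 / (N : ℝ) = 2 / Real.pi * (Real.pi * (1 / N)) := by field_simp
      _ ≤ _ := by gcongr
  have hXT : X ≤ (1 - 1 / N) ^ 2 * T := by
    have h1 : X ≤ (1 - 2 / N) * T := by
      have h2 : (1 - 2 / N) * T - X = (Real.sin (Real.pi * W' - Real.pi * W) -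
          2 / N * (Real.sin (Real.pi * W') * Real.cos (Real.pi * W))) /
          (Real.cos (Real.pi * W) * Real.cos (Real.pi * W')) := by
        rw [hX, hT, Real.sin_sub]
        field_simp
        ring
      have h3 : 0 ≤ (1 - 2 / N) * T - X := by
        rw [h2]
        refine div_nonneg ?_ (by positivity)
        have h4 : Real.sin (Real.pi * W') * Real.cos (Real.pi * W) ≤ 1 :=
          mul_le_one₀ (Real.sin_le_one _) hcW.le (Real.cos_le_one _)
        have h5 : 2 / (N : ℝ) * (Real.sin (Real.pi * W') * Real.cos (Real.pi * W)) ≤ 2 / N :=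
          mul_le_of_le_one_right (by positivity) h4
        linarith
      linarith
    refine h1.trans (mul_le_mul_of_nonneg_right ?_ hT0.le)
    have : 2 / (N : ℝ) = 2 * (1 / N) := by ring
    nlinarith [sq_nonneg (1 / (N : ℝ))]
  -- The geometric mean of the two tangents shares the factor $(1-1/N)^2$ equally between the bands.
  have hτ : 0 < Real.sqrt (X * T) := Real.sqrt_pos.2 (mul_pos hX0 hT0)
  have hτX : X ≤ (1 - 1 / N) * Real.sqrt (X * T) := by
    refine abs_le_of_sq_le_sq' ?_ (by positivity) |>.2
    rw [mul_pow, Real.sq_sqrt (by positivity)]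
    nlinarith
  have hτT : Real.sqrt (X * T) ≤ (1 - 1 / N) * T := by
    refine Real.sqrt_le_iff.2 ⟨by positivity, ?_⟩
    nlinarith
  refine ⟨Real.sqrt (X * T), hτ, fun f hf => ?_, fun g hg => ?_⟩
  · have hf1 : Real.pi * (-W) ≤ Real.pi * f := mul_le_mul_of_nonneg_left hf.1 hpi.le
    have hf2 : Real.pi * f ≤ Real.pi * W := mul_le_mul_of_nonneg_left hf.2 hpi.le
    have hc : 0 < Real.cos (Real.pi * f) :=
      Real.cos_pos_of_mem_Ioo ⟨by linarith, by linarith⟩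
    refine ⟨hc, ?_⟩
    have h1 : |Real.sin (Real.pi * f)| ≤ X * Real.cos (Real.pi * f) := by
      rw [hX, div_mul_eq_mul_div, le_div_iff₀ hcW]
      refine le_trans (le_of_eq (by rw [abs_mul, abs_of_pos hcW])) (abs_le.2 (?_ :
        _ ≤ Real.sin (Real.pi * f) * Real.cos (Real.pi * W) ∧ _))
      have h2 : 0 ≤ Real.sin (Real.pi * W + Real.pi * f) :=
        Real.sin_nonneg_of_nonneg_of_le_pi (by linarith) (by linarith)
      have h3 : 0 ≤ Real.sin (Real.pi * W - Real.pi * f) :=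
        Real.sin_nonneg_of_nonneg_of_le_pi (by linarith) (by linarith)
      rw [Real.sin_add] at h2
      rw [Real.sin_sub] at h3
      constructor <;> linarith
    calc |Real.sin (Real.pi * f)| ≤ X * Real.cos (Real.pi * f) := h1
      _ ≤ ((1 - 1 / N) * Real.sqrt (X * T)) * Real.cos (Real.pi * f) := by gcongr
      _ = _ := by ring
  · have hg1 : Real.pi * W' ≤ Real.pi * g := mul_le_mul_of_nonneg_left hg.1 hpi.le
    have hg2 : Real.pi * g ≤ Real.pi * (1 - W') := mul_le_mul_of_nonneg_left hg.2 hpi.le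
    have hs : 0 < Real.sin (Real.pi * g) :=
      Real.sin_pos_of_pos_of_lt_pi (by linarith) (by linarith)
    refine ⟨hs, ?_⟩
    have h1 : T * |Real.cos (Real.pi * g)| ≤ Real.sin (Real.pi * g) := by
      rw [hT, div_mul_eq_mul_div, div_le_iff₀ hcW']
      refine le_trans (le_of_eq (by rw [abs_mul, abs_of_pos hsW'])) (abs_le.2 (?_ :
        _ ≤ Real.sin (Real.pi * W') * Real.cos (Real.pi * g) ∧ _))
      have h2 : 0 ≤ Real.sin (Real.pi * g - Real.pi * W') :=
        Real.sin_nonneg_of_nonneg_of_le_pi (by linarith) (by linarith)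
      have h3 : 0 ≤ Real.sin (Real.pi * g + Real.pi * W') :=
        Real.sin_nonneg_of_nonneg_of_le_pi (by linarith) (by linarith)
      rw [Real.sin_sub] at h2
      rw [Real.sin_add] at h3
      constructor <;> linarith
    calc Real.sqrt (X * T) * |Real.cos (Real.pi * g)|
        ≤ ((1 - 1 / N) * T) * |Real.cos (Real.pi * g)| := by gcongr
      _ = (1 - 1 / N) * (T * |Real.cos (Real.pi * g)|) := by ring
      _ ≤ _ := by gcongr

/-- Here $(1+y)/(1-y)$ is the Möbius coordinate $z = (\tau\cos\pi f+\sin\pi f)/(\tau\cos\pi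
f-\sin\pi f)$, in which the ratio of the two forms is $(z-s)/(z+s)$. -/
theorem trigForm_of_cos {τ s f : ℝ} (hτ : τ ≠ 0) (hc : Real.cos (Real.pi * f) ≠ 0)
    {y : ℝ} (hy : y = Real.sin (Real.pi * f) / (τ * Real.cos (Real.pi * f))) (hy1 : 1 - y ≠ 0) :
    trigForm (τ * (1 - s), 1 + s) f =
        τ * Real.cos (Real.pi * f) * (1 - y) * ((1 + y) / (1 - y) - s) ∧
      trigForm (τ * (1 + s), 1 - s) f =
        τ * Real.cos (Real.pi * f) * (1 - y) * ((1 + y) / (1 - y) + s) := by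
  have h : Real.sin (Real.pi * f) = y * (τ * Real.cos (Real.pi * f)) := by
    rw [hy]; field_simp
  have hz : (1 - y) * ((1 + y) / (1 - y)) = 1 + y := mul_div_cancel₀ _ hy1
  simp only [trigForm]
  exact ⟨by linear_combination (1 + s) * h - τ * Real.cos (Real.pi * f) * hz,
    by linear_combination (1 - s) * h - τ * Real.cos (Real.pi * f) * hz⟩

/-- Now $y$ is inverted, so $(1+y)/(1-y)$ is $-z$ and the roles of $+s$ and $-s$ are exchanged. -/
theorem trigForm_of_sin {τ s g : ℝ} (hs : Real.sin (Real.pi * g) ≠ 0)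
    {y : ℝ} (hy : y = τ * Real.cos (Real.pi * g) / Real.sin (Real.pi * g)) (hy1 : 1 - y ≠ 0) :
    trigForm (τ * (1 - s), 1 + s) g =
        Real.sin (Real.pi * g) * (1 - y) * ((1 + y) / (1 - y) + s) ∧
      trigForm (τ * (1 + s), 1 - s) g =
        Real.sin (Real.pi * g) * (1 - y) * ((1 + y) / (1 - y) - s) := by
  have h : τ * Real.cos (Real.pi * g) = y * Real.sin (Real.pi * g) := by
    rw [hy]; field_simp
  have hz : (1 - y) * ((1 + y) / (1 - y)) = 1 + y := mul_div_cancel₀ _ hy1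
  simp only [trigForm]
  exact ⟨by linear_combination (1 - s) * h - Real.sin (Real.pi * g) * hz,
    by linear_combination (1 + s) * h - Real.sin (Real.pi * g) * hz⟩

/-- Rational functions on the circle, with `n = p * m` zeros, that are small on the band and whose
reciprocals are small on the complementary band. -/
theorem exists_separating_forms {N p : ℕ} (hN : 0 < N) (hp : 2 ≤ p) (hpN : 2 * N ≤ 3 ^ (p - 1))
    (m : ℕ) {W W' : ℝ} (hW : 0 < W) (hWW : W + 1 / N ≤ W') (hW' : W' < 1 / 2) :
    ∃ P Q : ℕ → ℝ × ℝ, (∀ i, ∀ f ∈ Set.Icc (-W) W, trigForm (Q i) f ≠ 0) ∧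
      (∀ f ∈ Set.Icc (-W) W, |trigRatio P Q (p * m) f| ≤ (1 / 4) ^ m) ∧
      (∀ g ∈ Set.Icc W' (1 - W'), 0 < |∏ i ∈ Finset.range (p * m), trigForm (P i) g| ∧
        |∏ i ∈ Finset.range (p * m), trigForm (Q i) g| ≤
          (1 / 4) ^ m * |∏ i ∈ Finset.range (p * m), trigForm (P i) g|) := by
  have hN' : (0 : ℝ) < N := by exact_mod_cast hN
  have hn : 0 < 1 / (N : ℝ) := by positivity
  obtain ⟨τ, hτ, hin, hout⟩ := exists_balancing_scale hN hW hWW hW'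
  refine ⟨fun i => (τ * (1 - shift N p i), 1 + shift N p i),
    fun i => (τ * (1 + shift N p i), 1 - shift N p i), ?_⟩
  have hu : ∀ y : ℝ, |y| ≤ 1 - 1 / N → 0 < 1 - y ∧ 0 < (1 + y) / (1 - y) := fun y hy => by
    obtain ⟨h1, h2⟩ := abs_le.1 hy
    exact ⟨by linarith, div_pos (by linarith) (by linarith)⟩
  have hyin : ∀ f ∈ Set.Icc (-W) W,
      |Real.sin (Real.pi * f) / (τ * Real.cos (Real.pi * f))| ≤ 1 - 1 / N := fun f hf => by
    obtain ⟨hc, h⟩ := hin f hf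
    rw [abs_div, abs_of_pos (mul_pos hτ hc), div_le_iff₀ (mul_pos hτ hc)]
    exact h
  have hyout : ∀ g ∈ Set.Icc W' (1 - W'),
      |τ * Real.cos (Real.pi * g) / Real.sin (Real.pi * g)| ≤ 1 - 1 / N := fun g hg => by
    obtain ⟨hs, h⟩ := hout g hg
    rw [abs_div, abs_of_pos hs, div_le_iff₀ hs, abs_mul, abs_of_pos hτ]
    exact h
  refine ⟨fun i f hf => ?_, fun f hf => ?_, fun g hg => ?_⟩
  · obtain ⟨hc, -⟩ := hin f hf
    obtain ⟨h1, h2⟩ := hu _ (hyin f hf)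
    rw [(trigForm_of_cos hτ.ne' hc.ne' rfl h1.ne').2]
    have := shift_pos hN p i
    positivity
  · obtain ⟨hc, -⟩ := hin f hf
    obtain ⟨h1, h2⟩ := hu _ (hyin f hf)
    rw [trigRatio, Finset.abs_prod]
    refine le_trans (le_of_eq (Finset.prod_congr rfl fun i _ => ?_))
      (prod_shift_le hN hp hpN m (hyin f hf))
    obtain ⟨e1, e2⟩ := trigForm_of_cos (s := shift N p i) hτ.ne' hc.ne' rfl h1.ne'
    rw [e1, e2, mul_div_mul_left _ _ (by positivity)]
  · obtain ⟨hs, -⟩ := hout g hg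
    obtain ⟨h1, h2⟩ := hu _ (hyout g hg)
    have hP : ∀ i, 0 < |trigForm (τ * (1 - shift N p i), 1 + shift N p i) g| := fun i => by
      rw [(trigForm_of_sin hs.ne' rfl h1.ne').1]
      have := shift_pos hN p i
      positivity
    rw [Finset.abs_prod, Finset.abs_prod]
    refine ⟨Finset.prod_pos fun i _ => hP i, ?_⟩
    rw [← div_le_iff₀ (Finset.prod_pos fun i _ => hP i), ← Finset.prod_div_distrib]
    refine le_trans (le_of_eq (Finset.prod_congr rfl fun i _ => ?_))
      (prod_shift_le hN hp hpN m (hyout g hg))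
    obtain ⟨e1, e2⟩ := trigForm_of_sin (τ := τ) (s := shift N p i) hs.ne' rfl h1.ne'
    rw [e1, e2, ← abs_div, mul_div_mul_left _ _ (by positivity)]

end Separation

/-! ### Decay of the singular values -/

section SingularValues

/-- Exponential decay of the singular values of the leakage matrix `F̄ᴴ B`. -/
theorem singular_value_le {N : ℕ} (hN : 0 < N) {W : ℝ} (hW0 : 0 < W) (hW : W < 1 / 2)
    (hM : 4 ≤ highDim N W) {p m k : ℕ} (hp : 2 ≤ p) (hpN : 2 * N ≤ 3 ^ (p - 1))
    (hk : p * m + 2 ≤ k) (hkM : k < highDim N W)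
    {U : Matrix (Fin (highDim N W)) (Fin (highDim N W)) ℂ} {σ : ℕ → ℝ}
    {Y : Matrix (Fin N) (Fin N) ℂ} (hA : IsSVD ((highDFT N W)ᴴ * prolate N W) U σ Y) :
    σ k ≤ (1 / 16) ^ m := by
  have hN' : (0 : ℝ) < N := by exact_mod_cast hN
  set K := bandIndex N W with hK
  have hKW : N * W < K + 1 := Nat.lt_floor_add_one _
  have hKN : 2 * K + 5 ≤ N := by unfold highDim at hM; omega
  have hKN' : 2 * (K : ℝ) + 5 ≤ N := by exact_mod_cast hKN
  -- The frequency $(K+1)/N$ may be arbitrarily close to the band edge; starting at $(K+2)/N$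
  -- guarantees a gap of $1/N$.
  set W' : ℝ := (K + 2) / N with hW'
  have hWW : W + 1 / N ≤ W' := by
    rw [hW', le_div_iff₀ hN', add_mul, one_div, inv_mul_cancel₀ hN'.ne']
    linarith
  have hW'2 : W' < 1 / 2 := by
    rw [hW', div_lt_iff₀ hN']
    linarith
  obtain ⟨P, Q, hQ, hR, hPQ⟩ := exists_separating_forms hN hp hpN m hW0 hWW hW'2
  obtain ⟨T, hT⟩ := exists_functionals_trigRatio (N := N) hW0.le P Q hQ (p * m)
  set i₀ : Fin (highDim N W) := ⟨0, by omega⟩ with hi₀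
  set i₁ : Fin (highDim N W) := ⟨highDim N W - 1, by omega⟩ with hi₁
  set A := (highDFT N W)ᴴ * prolate N W with hAdef
  let row : Fin (highDim N W) → ((Fin N → ℂ) →ₗ[ℂ] ℂ) := fun i =>
    (LinearMap.proj i) ∘ₗ A.mulVecLin
  -- Besides the $pm$ moments, two conditions annihilate the first and last rows, whose frequencies
  -- lie outside $[W', 1-W']$; hence the offset 2.
  obtain ⟨x, hx0, hTx, hxA⟩ := hA.exists_stretched (T.prod ((row i₀).prod (row i₁))) hkM
    (lt_of_lt_of_le hkM (by unfold highDim; omega))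
    (by simp only [Module.finrank_prod, Module.finrank_fintype_fun_eq_card, Fintype.card_fin,
          Module.finrank_self]; omega)
  obtain ⟨hTx, hx_rows⟩ := Prod.mk_eq_zero.1 (show (T x, (row i₀ x, row i₁ x)) = 0 from hTx)
  obtain ⟨hx_first, hx_last⟩ := Prod.mk_eq_zero.1 hx_rows
  have hRc : ContinuousOn (fun f => (trigRatio P Q (p * m) f : ℂ)) (Set.Icc (-W) W) :=
    Complex.continuous_ofReal.comp_continuousOn (continuousOn_trigRatio hQ _)
  set y := bandMultiplier N W (fun f => (trigRatio P Q (p * m) f : ℂ)) x with hy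
  have hAx : A *ᵥ x = (highDFT N W)ᴴ *ᵥ bandMultiplier N W 1 x := by
    rw [← prolate_mulVec, Matrix.mulVec_mulVec]
  have hrow : ∀ i, ‖(A *ᵥ x) i‖ ≤ (1 / 4) ^ m * ‖((highDFT N W)ᴴ *ᵥ y) i‖ := by
    intro i
    by_cases h0 : i = i₀
    · have : (A *ᵥ x) i = 0 := by rw [h0]; exact hx_first
      rw [this, norm_zero]
      positivity
    by_cases h1 : i = i₁
    · have : (A *ᵥ x) i = 0 := by rw [h1]; exact hx_last
      rw [this, norm_zero]
      positivity
    have hi1 : 1 ≤ (i : ℕ) := by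
      have : (i : ℕ) ≠ 0 := fun h => h0 (Fin.ext h)
      omega
    have hi2 : (i : ℕ) + 2 * K + 3 ≤ N := by
      have h2 : (i : ℕ) ≠ highDim N W - 1 := fun h => h1 (Fin.ext h)
      have h3 := i.2
      unfold highDim at h2 h3
      omega
    have hi1' : (1 : ℝ) ≤ (i : ℕ) := by exact_mod_cast hi1
    have hi2' : ((i : ℕ) : ℝ) + 2 * K + 3 ≤ N := by exact_mod_cast hi2
    set g : ℝ := ((K : ℝ) + 1 + ((i : ℕ) : ℝ)) / (N : ℝ) with hg
    have hgmem : g ∈ Set.Icc W' (1 - W') := by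
      constructor
      · rw [hg, hW']
        exact div_le_div_of_nonneg_right (by linarith) hN'.le
      · rw [hg, hW', div_le_iff₀ hN', sub_mul, div_mul_cancel₀ _ hN'.ne']
        linarith
    obtain ⟨hP0, hQP⟩ := hPQ g hgmem
    have h4 := hT x hTx g ⟨(K : ℤ) + 1 + (i : ℕ), by
      rw [hg, mul_div_cancel₀ _ hN'.ne']; push_cast; ring⟩
    have h5 := highDFT_mulVec_bandMultiplier hW0.le hRc x i
    have h6 := highDFT_mulVec_bandMultiplier (ω := 1) hW0.le continuousOn_const x i
    rw [← hy, ← hK, ← hg] at h5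
    rw [← hAx, ← hK, ← hg] at h6
    simp only [Pi.one_apply, one_mul] at h6
    have h7 : ((∏ i ∈ Finset.range (p * m), trigForm (Q i) g : ℝ) : ℂ) *
        ((highDFT N W)ᴴ *ᵥ y) i =
        ((∏ i ∈ Finset.range (p * m), trigForm (P i) g : ℝ) : ℂ) * (A *ᵥ x) i := by
      rw [h5, h6, mul_left_comm, h4, mul_left_comm]
    have h8 := congrArg norm h7
    rw [norm_mul, norm_mul, Complex.norm_real, Complex.norm_real, Real.norm_eq_abs,
      Real.norm_eq_abs] at h8
    refine le_of_mul_le_mul_left ?_ hP0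
    rw [← h8, ← mul_assoc, mul_comm _ ((1 / 4 : ℝ) ^ m)]
    gcongr
  have hsum : ∑ i, ‖(A *ᵥ x) i‖ ^ 2 ≤ ((1 / 16) ^ m) ^ 2 * ∑ n, ‖x n‖ ^ 2 := by
    have h4 : ((1 / 4 : ℝ) ^ m) ^ 2 = (1 / 16) ^ m := by
      rw [← pow_mul, mul_comm, pow_mul]; norm_num
    calc ∑ i, ‖(A *ᵥ x) i‖ ^ 2 ≤ ∑ i, ((1 / 4) ^ m * ‖((highDFT N W)ᴴ *ᵥ y) i‖) ^ 2 :=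
          Finset.sum_le_sum fun i _ => pow_le_pow_left₀ (norm_nonneg _) (hrow i) 2
      _ = (1 / 16) ^ m * ∑ i, ‖((highDFT N W)ᴴ *ᵥ y) i‖ ^ 2 := by
          simp only [mul_pow, h4, Finset.mul_sum]
      _ ≤ (1 / 16) ^ m * ∑ n, ‖y n‖ ^ 2 := by
          gcongr
          exact sum_norm_sq_highDFT_le hN hW0 hW y
      _ ≤ (1 / 16) ^ m * (((1 / 4) ^ m) ^ 2 * ∑ n, ‖x n‖ ^ 2) := by
          gcongr
          refine sum_norm_sq_bandMultiplier_le hW0.le hW.le hRc (fun f hf => ?_) x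
          rw [Complex.norm_real, Real.norm_eq_abs]
          exact hR f hf
      _ = _ := by rw [h4]; ring
  have h9 := le_of_mul_le_mul_right (hxA.trans hsum) hx0
  exact (abs_le_of_sq_le_sq' h9 (by positivity)).2

/-- Geometric summation of the singular value bound. -/
theorem sum_singular_values_le {σ : ℕ → ℝ} {p M R : ℕ} (hp : 0 < p) (hσ0 : ∀ k, 0 ≤ σ k)
    (hσ : ∀ m k, p * m + 2 ≤ k → k < M → σ k ≤ (1 / 16) ^ m) {m₀ : ℕ} (hR : p * m₀ + 2 ≤ R) :
    ∑ k ∈ Finset.Ico R M, σ k ≤ p * (16 / 15) * (1 / 16) ^ m₀ := by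
  by_cases hRM : M ≤ R
  · rw [Finset.Ico_eq_empty (by omega), Finset.sum_empty]
    positivity
  -- Extending by zero past `M` makes every block exactly `p` long; the bound is the partial
  -- geometric sum of the blocks.
  have key : ∀ n : ℕ, ∑ k ∈ Finset.Ico R (R + p * n), (if k < M then σ k else 0) ≤
      p * (16 / 15) * ((1 / 16) ^ m₀ - (1 / 16) ^ (m₀ + n)) := by
    intro n
    induction n with
    | zero => simp
    | succ n ih =>
      rw [← Finset.sum_Ico_consecutive _ (Nat.le_add_right R (p * n))
        (show R + p * n ≤ R + p * (n + 1) by rw [Nat.mul_succ]; omega)]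
      have h1 : ∑ k ∈ Finset.Ico (R + p * n) (R + p * (n + 1)), (if k < M then σ k else 0) ≤
          p * (1 / 16) ^ (m₀ + n) := by
        calc _ ≤ ∑ k ∈ Finset.Ico (R + p * n) (R + p * (n + 1)), ((1 : ℝ) / 16) ^ (m₀ + n) := by
              refine Finset.sum_le_sum fun k hk => ?_
              have hk' := (Finset.mem_Ico.1 hk).1
              split_ifs with h
              · exact hσ _ _ (by rw [Nat.mul_add]; omega) h
              · positivity
          _ = _ := by
              rw [Finset.sum_const, Nat.card_Ico, nsmul_eq_mul]
              congr 2
              rw [Nat.mul_succ]; omega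
      have h2 : ((1 : ℝ) / 16) ^ (m₀ + (n + 1)) = 1 / 16 * (1 / 16) ^ (m₀ + n) := by ring
      rw [h2]
      linarith
  have h3 := key M
  have h4 : ∑ k ∈ Finset.Ico R M, σ k ≤
      ∑ k ∈ Finset.Ico R (R + p * M), (if k < M then σ k else 0) := by
    calc _ = ∑ k ∈ Finset.Ico R M, (if k < M then σ k else 0) :=
          Finset.sum_congr rfl fun k hk => (if_pos (Finset.mem_Ico.1 hk).2).symm
      _ ≤ _ := by
          refine Finset.sum_le_sum_of_subset_of_nonneg (Finset.Ico_subset_Ico_right ?_) ?_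
          · nlinarith
          · intro k _ _
            split_ifs
            · exact hσ0 k
            · exact le_rfl
  refine h4.trans (h3.trans ?_)
  gcongr
  have : (0 : ℝ) ≤ (1 / 16) ^ (m₀ + M) := by positivity
  linarith

end SingularValues

/-! ### Numerical constants -/

section Constants

theorem log_three_gt : 1.097 < Real.log 3 := by
  -- From $2^{19} = 524288 \le 531441 = 3^{12}$.
  have h1 : 19 * Real.log 2 ≤ 12 * Real.log 3 := by
    have h := Real.log_le_log (x := 2 ^ 19) (y := 3 ^ 12) (by positivity) (by norm_num)
    rw [Real.log_pow, Real.log_pow] at h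
    exact_mod_cast h
  have := Real.log_two_gt_d9
  linarith

theorem six_le_C {N : ℕ} (hN : 0 < N) : 6 ≤ C N := by
  have hN' : (1 : ℝ) ≤ N := by exact_mod_cast hN
  have : 0 ≤ Real.log (8 * (N : ℝ)) := Real.log_nonneg (by linarith)
  have : 0 ≤ 4 / Real.pi ^ 2 * Real.log (8 * (N : ℝ)) := by positivity
  unfold C
  linarith

/-- Each unit of $p$ adds $\log 3$ to the lower bound for $\log(2N)$, and $0.405 \cdot 1.097 >
0.444$; the summand 6 in $C_N$ pays for the offset. -/
theorem le_C {N p : ℕ} (hN : 0 < N) (hp : 2 ≤ p) (h : 3 ^ (p - 2) ≤ 2 * N) :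
    0.444 * (p : ℝ) ≤ C N := by
  have hN' : (1 : ℝ) ≤ N := by exact_mod_cast hN
  obtain ⟨n, rfl⟩ : ∃ n, p = n + 2 := ⟨p - 2, by omega⟩
  have h1 : (3 : ℝ) ^ n ≤ 2 * N := by exact_mod_cast h
  have h2 : n * Real.log 3 ≤ Real.log (2 * N) := by
    have := Real.log_le_log (by positivity) h1
    rwa [Real.log_pow] at this
  have h3 : Real.log (8 * (N : ℝ)) = 2 * Real.log 2 + Real.log (2 * N) := by
    rw [show (8 : ℝ) * N = 2 ^ 2 * (2 * N) by ring, Real.log_mul (by positivity) (by positivity),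
      Real.log_pow]
    push_cast; ring
  have h4 := Real.log_two_gt_d9
  have h5 : 1.097 * (n : ℝ) ≤ n * Real.log 3 := by
    rw [mul_comm]
    exact mul_le_mul_of_nonneg_left log_three_gt.le (Nat.cast_nonneg n)
  have h6 : 0.405 ≤ 4 / Real.pi ^ 2 := by
    rw [le_div_iff₀ (by positivity)]
    nlinarith [Real.pi_lt_d4, Real.pi_pos]
  have h7 : 1.386 + 1.097 * (n : ℝ) ≤ Real.log (8 * (N : ℝ)) := by
    rw [h3]
    linarith
  have h8 : 0.405 * (1.386 + 1.097 * (n : ℝ)) ≤ 4 / Real.pi ^ 2 * Real.log (8 * (N : ℝ)) :=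
    mul_le_mul h6 h7 (by positivity) (by positivity)
  unfold C
  push_cast
  linarith

/-- The choice of `R` makes the discarded singular values summable below `ε² / (4π)`. -/
theorem sum_discarded_le {N : ℕ} (hN : 0 < N) {ε : ℝ} (hε0 : 0 < ε) (hε : ε < 1 / 2) {R M : ℕ}
    (hR : C N * Real.log (60 * Real.pi * C N / ε ^ 2) + 1 ≤ R) {σ : ℕ → ℝ} (hσ0 : ∀ k, 0 ≤ σ k)
    (hσ : ∀ p m k : ℕ, 4 ≤ M → 2 ≤ p → 2 * N ≤ 3 ^ (p - 1) → p * m + 2 ≤ k → k < M →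
      σ k ≤ (1 / 16) ^ m) :
    ∑ k ∈ Finset.Ico R M, σ k ≤ ε ^ 2 / (4 * Real.pi) := by
  have hpi := Real.pi_gt_three
  by_cases hRM : M ≤ R
  · rw [Finset.Ico_eq_empty (by omega), Finset.sum_empty]
    positivity
  have hC6 := six_le_C hN
  set c := C N with hc
  set L := Real.log (60 * Real.pi * c / ε ^ 2) with hL
  have hexpL : Real.exp L = 60 * Real.pi * c / ε ^ 2 := Real.exp_log (by positivity)
  have hL5 : 5 ≤ L := by
    rw [hL, Real.le_log_iff_exp_le (by positivity), le_div_iff₀ (by positivity)]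
    have h1 : Real.exp 5 ≤ 3 ^ 5 := by
      rw [show (5 : ℝ) = ((5 : ℕ) : ℝ) * 1 by norm_num, Real.exp_nat_mul]
      exact pow_le_pow_left₀ (Real.exp_pos 1).le (by linarith [Real.exp_one_lt_d9]) 5
    have h2 : ε ^ 2 ≤ 1 := by nlinarith
    calc Real.exp 5 * ε ^ 2 ≤ 3 ^ 5 * 1 := by gcongr
      _ ≤ 60 * 3 * 6 := by norm_num
      _ ≤ 60 * Real.pi * c := by gcongr
  -- Far more than needed: $R \ge 2$ for the offset, and $M > R$ then gives $M \ge 4$.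
  have hR31 : (31 : ℝ) ≤ R := by nlinarith
  have hR31' : 31 ≤ R := by exact_mod_cast hR31
  set p := Nat.clog 3 (2 * N) + 1 with hp
  have hclog : 0 < Nat.clog 3 (2 * N) := Nat.clog_pos (by norm_num) (by omega)
  have hp2 : 2 ≤ p := by omega
  have hpN : 2 * N ≤ 3 ^ (p - 1) := by
    rw [hp, Nat.add_sub_cancel]
    exact Nat.le_pow_clog (by norm_num) _
  have hpN' : 3 ^ (p - 2) ≤ 2 * N := by
    have := Nat.pow_pred_clog_lt_self (b := 3) (by norm_num) (x := 2 * N) (by omega)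
    rw [Nat.pred_eq_sub_one] at this
    rw [hp, show Nat.clog 3 (2 * N) + 1 - 2 = Nat.clog 3 (2 * N) - 1 by omega]
    exact this.le
  have hpc : 0.444 * (p : ℝ) ≤ c := le_C hN hp2 hpN'
  have hp0 : (0 : ℝ) < p := by exact_mod_cast (by omega : 0 < p)
  set m₀ := (R - 2) / p with hm₀
  have hm1 : p * m₀ + 2 ≤ R := by
    have := Nat.mul_div_le (R - 2) p
    rw [← hm₀] at this
    omega
  have hm2 : (R : ℝ) - 1 ≤ p * ((m₀ : ℝ) + 1) := by
    have h1 := Nat.lt_mul_div_succ (R - 2) (by omega : 0 < p)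
    have h2 : R ≤ p * (m₀ + 1) + 1 := by
      rw [hm₀]
      omega
    have h3 : (R : ℝ) ≤ p * ((m₀ : ℝ) + 1) + 1 := by exact_mod_cast h2
    linarith
  refine (sum_singular_values_le (by omega) hσ0 (fun m k h1 h2 => hσ p m k (by omega) hp2 hpN h1 h2)
    hm1).trans ?_
  have hlog16 : 2.772 ≤ Real.log 16 := by
    rw [show (16 : ℝ) = 2 ^ 4 by norm_num, Real.log_pow]
    have := Real.log_two_gt_d9
    push_cast
    linarith
  -- The rate exceeds 1 by $1/5$; with $L \ge 5$ this yields a spare factor $e^{-1}$.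
  have hrate : 6 / 5 * L ≤ Real.log 16 * ((m₀ : ℝ) + 1) := by
    have h1 : 0.444 * p * L ≤ p * ((m₀ : ℝ) + 1) := by
      have : 0.444 * p * L ≤ c * L := by gcongr
      linarith
    have h2 : 0.444 * L ≤ (m₀ : ℝ) + 1 := by
      refine le_of_mul_le_mul_left ?_ hp0
      linarith
    calc 6 / 5 * L ≤ 2.772 * (0.444 * L) := by linarith
      _ ≤ _ := by gcongr
  have hpow : ((1 : ℝ) / 16) ^ m₀ ≤ 16 * (Real.exp (-1) * (ε ^ 2 / (60 * Real.pi * c))) := by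
    have h1 : ((1 : ℝ) / 16) ^ m₀ = 16 * Real.exp (-(Real.log 16 * ((m₀ : ℝ) + 1))) := by
      have h2 : -(Real.log 16 * ((m₀ : ℝ) + 1)) = (m₀ + 1 : ℕ) * -Real.log 16 := by
        push_cast; ring
      rw [h2, Real.exp_nat_mul, Real.exp_neg, Real.exp_log (by norm_num), pow_succ, one_div]
      ring
    rw [h1]
    have h2 : ε ^ 2 / (60 * Real.pi * c) = Real.exp (-L) := by
      rw [Real.exp_neg, hexpL, inv_div]
    rw [h2, ← Real.exp_add]
    gcongr
    linarith
  have hexp1 : Real.exp (-1) ≤ 0.39 := by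
    rw [Real.exp_neg]
    refine inv_le_of_inv_le₀ (by norm_num) ?_
    have := Real.exp_one_gt_d9
    norm_num at this ⊢
    linarith
  -- The constants fit narrowly: the resulting coefficient is about 0.9994.
  calc (p : ℝ) * (16 / 15) * (1 / 16) ^ m₀
      ≤ (c / 0.444) * (16 / 15) * (16 * (0.39 * (ε ^ 2 / (60 * Real.pi * c)))) := by
        gcongr
        · rw [le_div_iff₀ (by norm_num)]
          linarith
        · exact hpow.trans (by gcongr)
    _ = (16 / 15 * 16 * 0.39 / 0.444 / 15) * (ε ^ 2 / (4 * Real.pi)) := by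
        field_simp
        ring
    _ ≤ 1 * (ε ^ 2 / (4 * Real.pi)) := by
        gcongr
        norm_num
    _ = _ := one_mul _

end Constants

section Projection

theorem sum_norm_sq_projection_le {n : Type*} [Fintype n] [DecidableEq n] {P : Matrix n n ℂ}
    (hP : Pᴴ = P) (hPP : P * P = P) (x : n → ℂ) :
    ∑ i, ‖(P *ᵥ x) i‖ ^ 2 ≤ ∑ i, ‖x i‖ ^ 2 := by
  have key : ∀ Q : Matrix n n ℂ, Qᴴ = Q → Q * Q = Q →
      ((∑ i, ‖(Q *ᵥ x) i‖ ^ 2 : ℝ) : ℂ) = star x ⬝ᵥ (Q *ᵥ x) := fun Q h1 h2 => by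
    rw [← star_dotProduct_self, Matrix.star_mulVec, ← Matrix.dotProduct_mulVec,
      Matrix.mulVec_mulVec, h1, h2]
  have h1 := key P hP hPP
  have h2 := key (1 - P) (by rw [Matrix.conjTranspose_sub, hP, Matrix.conjTranspose_one])
    (IsIdempotentElem.one_sub hPP).eq
  have h3 : ((∑ i, ‖(P *ᵥ x) i‖ ^ 2 + ∑ i, ‖((1 - P) *ᵥ x) i‖ ^ 2 : ℝ) : ℂ) =
      ((∑ i, ‖x i‖ ^ 2 : ℝ) : ℂ) := by
    rw [Complex.ofReal_add, h1, h2, ← dotProduct_add, ← Matrix.add_mulVec, ← star_dotProduct_self]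
    simp
  have h4 : ∑ i, ‖(P *ᵥ x) i‖ ^ 2 + ∑ i, ‖((1 - P) *ᵥ x) i‖ ^ 2 = ∑ i, ‖x i‖ ^ 2 := by
    exact_mod_cast h3
  have : 0 ≤ ∑ i, ‖((1 - P) *ᵥ x) i‖ ^ 2 := by positivity
  linarith

end Projection

end Roast

/-! ### The representation guarantee -/

theorem theorem5 (N : ℕ) (hN : 0 < N) (W : ℝ) (hW0 : 0 < W) (hW : W < 1 / 2)
    (hNW : 1 / (4 * Real.pi * (N : ℝ)) ≤ W) (ε : ℝ) (hε0 : 0 < ε) (hε : ε < 1 / 2)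
    (R : ℕ)
    (hR : (R : ℤ) = max
      (⌈Roast.C N * Real.log (60 * Real.pi * Roast.C N / ε ^ 2)⌉ + 1)
      (⌈Roast.C N * Real.log (15 * Roast.C N / ((N : ℝ) * W * ε))⌉ + 1))
    (V : Matrix (Fin (Roast.highDim N W)) (Fin (min R (Roast.highDim N W))) ℂ)
    (hV : Roast.IsDominantLeftSingular ((Roast.highDFT N W)ᴴ * Roast.prolate N W) V) :
    (Roast.basis N W V)ᴴ * Roast.basis N W V = 1 ∧
    ∀ f ∈ Set.Icc (-W) W,
      ‖Roast.sinusoid N f -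
          Matrix.toEuclideanLin (Roast.basis N W V * (Roast.basis N W V)ᴴ)
            (Roast.sinusoid N f)‖ ^ 2 /
        ‖Roast.sinusoid N f‖ ^ 2 ≤ ε := by
  open Roast in
  obtain ⟨U, σ, Y, h, hA, hVU⟩ := hV
  have hVV : Vᴴ * V = 1 := by rw [hVU]; exact submatrix_castLE_orthonormal h hA.left_unitary
  have hQ := basis_orthonormal hN hW0 hW hVV
  refine ⟨hQ, fun f hf => ?_⟩
  have hN' : (0 : ℝ) < N := by exact_mod_cast hN
  have hRR : C N * Real.log (60 * Real.pi * C N / ε ^ 2) + 1 ≤ R := by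
    have h1 : ⌈C N * Real.log (60 * Real.pi * C N / ε ^ 2)⌉ + 1 ≤ (R : ℤ) := by
      rw [hR]; exact le_max_left _ _
    have h2 : ((⌈C N * Real.log (60 * Real.pi * C N / ε ^ 2)⌉ : ℤ) : ℝ) + 1 ≤ R := by
      exact_mod_cast h1
    linarith [Int.le_ceil (C N * Real.log (60 * Real.pi * C N / ε ^ 2))]
  set Q := basis N W V with hQdef
  set P := 1 - Q * Qᴴ with hPdef
  have hP : Pᴴ = P := by simp [hPdef]
  have hPP : P * P = P := by
    have h1 : Q * Qᴴ * (Q * Qᴴ) = Q * Qᴴ := by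
      rw [Matrix.mul_assoc, ← Matrix.mul_assoc Qᴴ, hQ, Matrix.one_mul]
    exact (IsIdempotentElem.one_sub h1).eq
  have hnorm : ∀ x : EuclideanSpace ℂ (Fin N), ‖Matrix.toEuclideanLin P x‖ ^ 2 =
      ∑ i, ‖(P *ᵥ x.ofLp) i‖ ^ 2 := fun x => EuclideanSpace.norm_sq_eq _
  have hcontr : ∀ x, ‖Matrix.toEuclideanLin P x‖ ≤ ‖x‖ := fun x => by
    refine (sq_le_sq₀ (norm_nonneg _) (norm_nonneg _)).1 ?_
    rw [hnorm, EuclideanSpace.norm_sq_eq]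
    exact sum_norm_sq_projection_le hP hPP _
  have htrace : (P * prolate N W).trace = ((1 - V * Vᴴ) * ((highDFT N W)ᴴ * prolate N W) *
      highDFT N W).trace := by
    rw [hPdef, hQdef, one_sub_basis hN hW0 hW, Matrix.mul_assoc (highDFT N W), Matrix.mul_assoc,
      Matrix.trace_mul_comm]
    simp only [Matrix.mul_assoc]
  have htail : ∑ k ∈ Finset.Ico R (highDim N W), σ k ≤ ε ^ 2 / (4 * Real.pi) :=
    sum_discarded_le hN hε0 hε hRR hA.nonneg fun p m k hM hp hpN hk hkM =>
      singular_value_le hN hW0 hW hM hp hpN hk hkM hA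
  -- When `R` exceeds the number of high frequencies, nothing is discarded and both sums are empty.
  have hIco : ∑ k ∈ Finset.Ico (min R (highDim N W)) (highDim N W), σ k =
      ∑ k ∈ Finset.Ico R (highDim N W), σ k := by
    rcases le_total R (highDim N W) with h1 | h1
    · rw [min_eq_left h1]
    · rw [min_eq_right h1, Finset.Ico_self, Finset.Ico_eq_empty (by omega)]
  have hint : ∫ g in (-W)..W, ‖Matrix.toEuclideanLin P (sinusoid N g)‖ ^ 2 ≤
      ε ^ 2 / (4 * Real.pi) := by
    have h1 := integral_projection_energy N W hP hPP
    rw [htrace, hVU] at h1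
    have h2 := norm_trace_tail_le hA (dft_blocks hN hW0 hW).2.2.2 h
    rw [← h1, Complex.norm_real, hIco] at h2
    simp only [hnorm]
    exact (le_abs_self _).trans (h2.trans htail)
  have hcont : Continuous fun g => ‖Matrix.toEuclideanLin P (sinusoid N g)‖ ^ 2 := by
    simp only [hnorm, Matrix.mulVec, dotProduct]
    exact continuous_finsetSum _ fun i _ => ((continuous_finsetSum _ fun n _ =>
      continuous_const.mul (continuous_sinusoid_apply N n)).norm).pow 2
  have hfinal := le_of_lipschitz_of_integral_le hN' (fun g => by positivity) hcont
    (residual_lipschitz hcontr) hNW hε0 hε.le hint hf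
  have hres : sinusoid N f - Matrix.toEuclideanLin (Q * Qᴴ) (sinusoid N f) =
      Matrix.toEuclideanLin P (sinusoid N f) := by
    rw [hPdef, map_sub, LinearMap.sub_apply]
    congr 1
    simp [Matrix.toEuclideanLin]
  rw [hres, norm_sq_sinusoid, div_le_iff₀ hN', mul_comm]
  exact hfinal
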